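/- **Processes and configurations.** Let $\gamma$ range over finite sets of natural numbers (channels). Processes $\gamma\vdash P$ are the possibly infinite terms, up to renaming of bound channels, coinductively generated by finite guarded sums $\sum_{i\in n} g_i$ and binary parallel compositions $P\mid Q$, where a guarded process $g$ over $\gamma$ is one of $\nu a.P$ ($\gamma,a\vdash P$), $\heartsuit.P$, $\tau.P$ ($\gamma\vdash P$), $a(b).P$ ($a\in\gamma$, $\gamma,b\vdash P$), $\bar a\langle b\rangle.P$ ($a,b\in\gamma$, $\gamma\vdash P$). A configuration $\langle\gamma\,\|\,S\rangle$ is a $\gamma$ with a finite multiset $S$ of processes over $\gamma$. Besides identity $\tau$-transitions, transitions with labels in $\{\tau,\heartsuit\}$ are generated by (with $R,R'$ denoting the other summands): $\langle\gamma\|P\mid Q\rangle\xrightarrow{\tau}\langle\gamma\|P,Q\rangle$; $\langle\gamma\|\tau.P+R\rangle\xrightarrow{\tau}\langle\gamma\|P\rangle$; $\langle\gamma\|\heartsuit.P+R\rangle\xrightarrow{\heartsuit}\langle\gamma\|P\rangle$; $\langle\gamma\|\nu a.P+R\rangle\xrightarrow{\tau}\langle\gamma,a\|P\rangle$ for $a\notin\gamma$;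 $\langle\gamma\|a(b).P+R,\ \bar a\langle c\rangle.Q+R'\rangle\xrightarrow{\tau}\langle\gamma\|P[b\mapsto c],Q\rangle$; and closure under adding a multiset of further processes (weakened along $\gamma_1\subseteq\gamma_2$ in the target). **Behaviours.** The basic actions from $[n]$ ($n\in\mathbb N$) are $\pi^l_n,\pi^r_n,\tau_n,\heartsuit_n\colon[n]\to[n]$, $\nu_n\colon[n]\to[n+1]$, $\iota_{n,a}\colon[n]\to[n+1]$ and $o_{n,a,b}\colon[n]\to[n]$, for $a,b\in\{1,\dots,n\}$ (written here from initial to final arity). Views on $[n]$ are composable sequences of basic actions starting at $[n]$; they form a category whose morphisms $u\to u'$ are the views $w$ with $u\bullet w=u'$. A behaviour $B$ on $[n]$ is a presheaf of finite sets on it; $|B|$ is its value at the empty view, and $B$ is definite if $|B|$ is a singleton. For a basic action $b$, the residual $B\cdot b$ is $(B\cdot b)(w)=B(b\bullet w)$; for $i\in|B|$, $B|_i$ is the definite subpresheaf of the states that restrict to $i$. **Mixed behaviours.** A mixed behaviour $\langle\gamma\,\|\,D_1[\sigma_1],\dots,D_p[\sigma_p]\rangle$ is a finite set $\gamma$ of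 channels with a finite multiset of triples $(n_k,D_k,\sigma_k)$, where $D_k$ is a definite behaviour on $[n_k]$ and $\sigma_k\colon\{1,\dots,n_k\}\to\gamma$ is any map. Besides identity $\tau$-transitions, the transitions of $\mathbb M$ are generated by $\langle\gamma\|D[\sigma]\rangle\xrightarrow{\tau}\langle\gamma\|(D\cdot\pi^l_n)|_i[\sigma],(D\cdot\pi^r_n)|_j[\sigma]\rangle$; $\langle\gamma\|D[\sigma]\rangle\xrightarrow{\tau}\langle\gamma\|(D\cdot\tau_n)|_i[\sigma]\rangle$; $\langle\gamma\|D[\sigma]\rangle\xrightarrow{\heartsuit}\langle\gamma\|(D\cdot\heartsuit_n)|_i[\sigma]\rangle$; $\langle\gamma\|D[\sigma]\rangle\xrightarrow{\tau}\langle\gamma,a\|(D\cdot\nu_n)|_i[\sigma,n{+}1\mapsto a]\rangle$ for $a\notin\gamma$; $\langle\gamma\|D_1[\sigma_1],D_2[\sigma_2]\rangle\xrightarrow{\tau}\langle\gamma\|(D_1\cdot\iota_{n_1,a_1})|_i[\sigma_1,n_1{+}1\mapsto\sigma_2(b_2)],(D_2\cdot o_{n_2,a_2,b_2})|_j[\sigma_2]\rangle$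 when $\sigma_1(a_1)=\sigma_2(a_2)$ (with $i,j$ ranging over the initial states of the residuals involved); and closure under adding a multiset of further elements, as for configurations. **Translation.** For $\gamma\vdash P$, $n=|\gamma|$ and a bijection $h\colon\gamma\to\{1,\dots,n\}$, let $[\![P]\!]_h$ be the definite behaviour on $[n]$ coinductively determined by: $[\![P\mid Q]\!]_h$ has residual $[\![P]\!]_h$ along $\pi^l_n$, $[\![Q]\!]_h$ along $\pi^r_n$, and empty residuals along all other basic actions; $[\![\sum_i g_i]\!]_h\cdot b=\coprod_i([\![g_i]\!]_h\cdot b)$; and the only non-empty residual of $[\![g]\!]_h$ is $[\![P]\!]_{h'}$ along $\nu_n$ if $g=\nu b.P$, $[\![P]\!]_h$ along $\heartsuit_n$ if $g=\heartsuit.P$, $[\![P]\!]_h$ along $\tau_n$ if $g=\tau.P$, $[\![P]\!]_{h'}$ along $\iota_{n,h(a)}$ if $g=a(b).P$, and $[\![P]\!]_h$ along $o_{n,h(a),h(b)}$ if $g=\bar a\langle b\rangle.P$, where $h'$ extends $h$ by $b\mapsto n+1$. Let $h_\gamma\colon\gamma\to\{1,\dots,|\gamma|\}$ be the increasing bijection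 and $$T\langle\gamma\,\|\,P_1,\dots,P_p\rangle=\langle\gamma\,\|\,[\![P_1]\!]_{h_\gamma}[h_\gamma^{-1}],\dots,[\![P_p]\!]_{h_\gamma}[h_\gamma^{-1}]\rangle.$$ **Fair testing.** In both systems put $\langle\gamma\|S\rangle\mathbin{@}\langle\gamma'\|S'\rangle=\langle\gamma\|S\cup S'\rangle$ if $\gamma=\gamma'$, and leave it undefined otherwise. Let $\bot$ be the set of states $x$ such that, for every finite sequence of $\tau$-transitions from $x$ to some $y$, there is a finite sequence of transitions from $y$ with exactly one label $\heartsuit$ and all others $\tau$. States $x,y$ are fair testing equivalent, $x\sim_f y$, if they have the same set of channels and, for every state $z$ with that set of channels, $x\mathbin{@}z\in\bot$ iff $y\mathbin{@}z\in\bot$. **Theorem.** The map $T$ from configurations to mixed behaviours is intensionally fully abstract for fair testing equivalence: 1. for all configurations $C_1,C_2$, $C_1\sim_f C_2$ if and only if $T(C_1)\sim_f T(C_2)$; 2. for every mixed behaviour $M$ there is a configuration $C$ with $T(C)\sim_f M$. -/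

import Mathlib

open CategoryTheory Opposite

namespace PiFair

/-! ### Infinite terms of the π-calculus -/

/-- Guarded terms over the set `V` of free channels, with continuations taken from `X`.
The channel bound by `νa.P` or `a(b).P` is the element `none` of `Option V`, so that
terms are represented up to renaming of bound channels. -/
inductive Guarded (X : Type → Type) (V : Type) : Type
  /-- name creation `ν b. P` -/
  | nu (P : X (Option V))
  /-- the success action `♡. P` -/
  | tick (P : X V)
  /-- the silent guard `τ. P` -/
  | tau (P : X V)
  /-- input `a(b). P` -/
  | inp (a : V) (P : X (Option V))
  /-- output `ā⟨b⟩. P` -/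
  | out (a b : V) (P : X V)

/-- One layer of syntax: a finite guarded sum or a binary parallel composition. -/
inductive Layer (X : Type → Type) (V : Type) : Type
  | sum (gs : List (Guarded X V))
  | par (P Q : X V)

section Layers

variable {X Y Z : Type → Type}

/-- Change the continuations. -/
def Guarded.map (f : ∀ V, X V → Y V) {V : Type} : Guarded X V → Guarded Y V
  | .nu P => .nu (f _ P)
  | .tick P => .tick (f _ P)
  | .tau P => .tau (f _ P)
  | .inp a P => .inp a (f _ P)
  | .out a b P => .out a b (f _ P)

/-- Change the continuations. -/
def Layer.map (f : ∀ V, X V → Y V) {V : Type} : Layer X V → Layer Y V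
  | .sum gs => .sum (gs.map (Guarded.map f))
  | .par P Q => .par (f _ P) (f _ Q)

/-- Apply a substitution of channels, given how to apply substitutions to continuations. -/
def Guarded.subst (r : ∀ V W, (V → W) → X V → X W) {V W : Type} (σ : V → W) :
    Guarded X V → Guarded X W
  | .nu P => .nu (r _ _ (Option.map σ) P)
  | .tick P => .tick (r _ _ σ P)
  | .tau P => .tau (r _ _ σ P)
  | .inp a P => .inp (σ a) (r _ _ (Option.map σ) P)
  | .out a b P => .out (σ a) (σ b) (r _ _ σ P)

/-- Apply a substitution of channels, given how to apply substitutions to continuations. -/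
def Layer.subst (r : ∀ V W, (V → W) → X V → X W) {V W : Type} (σ : V → W) :
    Layer X V → Layer X W
  | .sum gs => .sum (gs.map (Guarded.subst r σ))
  | .par P Q => .par (r _ _ σ P) (r _ _ σ Q)

theorem Guarded.map_map (f : ∀ V, X V → Y V) (g : ∀ V, Y V → Z V) {V : Type}
    (x : Guarded X V) : (x.map f).map g = x.map (fun V P => g V (f V P)) := by
  cases x <;> rfl

theorem Layer.map_map (f : ∀ V, X V → Y V) (g : ∀ V, Y V → Z V) {V : Type}
    (x : Layer X V) : (x.map f).map g = x.map (fun V P => g V (f V P)) := by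
  cases x <;> simp [Layer.map, Guarded.map_map]

theorem Layer.map_subst (f : ∀ V, X V → Y V) (r : ∀ V W, (V → W) → X V → X W)
    (r' : ∀ V W, (V → W) → Y V → Y W)
    (hr : ∀ V W (σ : V → W) (P : X V), f W (r V W σ P) = r' V W σ (f V P))
    {V W : Type} (σ : V → W) (x : Layer X V) :
    (x.subst r σ).map f = (x.map f).subst r' σ := by
  have hg : ∀ g : Guarded X V, (g.subst r σ).map f = (g.map f).subst r' σ := by
    intro g; cases g <;> simp [Guarded.subst, Guarded.map, hr]
  cases x <;> simp [Layer.map, Layer.subst, hr, hg]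

end Layers

/-- Terms over `V` cut off at depth `k`. -/
def Approx : ℕ → Type → Type
  | 0, _ => Unit
  | k + 1, V => Layer (Approx k) V

/-- Forget the deepest layer. -/
def Approx.trunc : ∀ (k : ℕ) (V : Type), Approx (k + 1) V → Approx k V
  | 0, _ => fun _ => ()
  | k + 1, _ => Layer.map (Approx.trunc k)

/-- Substitution of channels in terms cut off at depth `k`. -/
def Approx.subst : ∀ (k : ℕ) (V W : Type), (V → W) → Approx k V → Approx k W
  | 0, _, _, _ => fun _ => ()
  | k + 1, _, _, σ => Layer.subst (Approx.subst k) σ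

theorem Approx.trunc_subst : ∀ (k : ℕ) (V W : Type) (σ : V → W) (P : Approx (k + 1) V),
    Approx.trunc k W (Approx.subst (k + 1) V W σ P) = Approx.subst k V W σ (Approx.trunc k V P)
  | 0, _, _, _, _ => rfl
  | k + 1, _, _, σ, P => Layer.map_subst _ _ _ (Approx.trunc_subst k) σ P

/-- Processes with free channels in `V`: possibly infinite terms of the grammar, that is, the
final coalgebra of `Layer`, realised as coherent sequences of finite approximations. -/
def Proc (V : Type) : Type :=
  {p : ∀ k, Approx k V // ∀ k, Approx.trunc k V (p (k + 1)) = p k}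

namespace Proc

/-- The approximation of a process at depth `k`. -/
def approx (k : ℕ) (V : Type) (P : Proc V) : Approx k V := P.1 k

theorem trunc_approx (k : ℕ) (V : Type) (P : Proc V) :
    Approx.trunc k V (approx (k + 1) V P) = approx k V P := P.2 k

/-- Capture-avoiding substitution `P[σ]`. -/
def subst {V W : Type} (σ : V → W) (P : Proc V) : Proc W :=
  ⟨fun k => Approx.subst k V W σ (P.1 k), fun k => by
    rw [Approx.trunc_subst, P.2 k]⟩

/-- The process with a given outermost layer. -/
def fold {V : Type} (l : Layer Proc V) : Proc V :=
  ⟨fun k => match k with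
    | 0 => ()
    | k + 1 => l.map (approx k),
   fun k => match k with
    | 0 => rfl
    | k + 1 => by
      change (l.map (approx (k + 1))).map (Approx.trunc k) = l.map (approx k)
      rw [Layer.map_map]
      congr 1
      funext V P
      exact trunc_approx k V P⟩

/-- Guarded sum `∑ᵢ gᵢ`. -/
def sum {V : Type} (gs : List (Guarded Proc V)) : Proc V := fold (.sum gs)

/-- Parallel composition `P ∣ Q`. -/
def par {V : Type} (P Q : Proc V) : Proc V := fold (.par P Q)

theorem exists_guarded {V : Type} (g : ∀ k, Guarded (Approx k) V)
    (hg : ∀ k, (g (k + 1)).map (Approx.trunc k) = g k) :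
    ∃ G : Guarded Proc V, ∀ k, G.map (approx k) = g k := by
  cases h0 : g 0 with
  | nu P =>
    have h : ∀ k, ∃ P, g k = .nu P := by
      intro k
      induction k with
      | zero => exact ⟨P, h0⟩
      | succ k ih =>
        obtain ⟨Q, hQ⟩ := ih
        have := hg k
        cases hk : g (k + 1) <;> simp_all [Guarded.map]
    choose p hp using h
    refine ⟨.nu ⟨p, fun k => ?_⟩, fun k => (hp k).symm⟩
    have := hg k
    rw [hp, hp] at this
    exact Guarded.nu.inj this
  | tick P =>
    have h : ∀ k, ∃ P, g k = .tick P := by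
      intro k
      induction k with
      | zero => exact ⟨P, h0⟩
      | succ k ih =>
        obtain ⟨Q, hQ⟩ := ih
        have := hg k
        cases hk : g (k + 1) <;> simp_all [Guarded.map]
    choose p hp using h
    refine ⟨.tick ⟨p, fun k => ?_⟩, fun k => (hp k).symm⟩
    have := hg k
    rw [hp, hp] at this
    exact Guarded.tick.inj this
  | tau P =>
    have h : ∀ k, ∃ P, g k = .tau P := by
      intro k
      induction k with
      | zero => exact ⟨P, h0⟩
      | succ k ih =>
        obtain ⟨Q, hQ⟩ := ih
        have := hg k
        cases hk : g (k + 1) <;> simp_all [Guarded.map]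
    choose p hp using h
    refine ⟨.tau ⟨p, fun k => ?_⟩, fun k => (hp k).symm⟩
    have := hg k
    rw [hp, hp] at this
    exact Guarded.tau.inj this
  | inp a P =>
    have h : ∀ k, ∃ P, g k = .inp a P := by
      intro k
      induction k with
      | zero => exact ⟨P, h0⟩
      | succ k ih =>
        obtain ⟨Q, hQ⟩ := ih
        have := hg k
        cases hk : g (k + 1) <;> simp_all [Guarded.map]
    choose p hp using h
    refine ⟨.inp a ⟨p, fun k => ?_⟩, fun k => (hp k).symm⟩
    have := hg k
    rw [hp, hp] at this
    exact (Guarded.inp.inj this).2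
  | out a b P =>
    have h : ∀ k, ∃ P, g k = .out a b P := by
      intro k
      induction k with
      | zero => exact ⟨P, h0⟩
      | succ k ih =>
        obtain ⟨Q, hQ⟩ := ih
        have := hg k
        cases hk : g (k + 1) <;> simp_all [Guarded.map]
    choose p hp using h
    refine ⟨.out a b ⟨p, fun k => ?_⟩, fun k => (hp k).symm⟩
    have := hg k
    rw [hp, hp] at this
    exact (Guarded.out.inj this).2.2

theorem exists_list {V : Type} : ∀ (n : ℕ) (l : ∀ k, List (Guarded (Approx k) V)),
    (l 0).length = n → (∀ k, (l (k + 1)).map (Guarded.map (Approx.trunc k)) = l k) →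
    ∃ L : List (Guarded Proc V), ∀ k, L.map (Guarded.map (approx k)) = l k := by
  intro n l hn hl
  have hlen : ∀ k, (l k).length = n := by
    intro k
    induction k with
    | zero => exact hn
    | succ k ih => rw [← ih, ← hl k, List.length_map]
  clear hn
  induction n generalizing l with
  | zero => exact ⟨[], fun k => (List.eq_nil_of_length_eq_zero (hlen k)).symm⟩
  | succ n ih =>
    choose g t hgt using fun k => List.exists_cons_of_length_eq_add_one (hlen k)
    have hl' : ∀ k, (g (k + 1)).map (Approx.trunc k) = g k ∧
        (t (k + 1)).map (Guarded.map (Approx.trunc k)) = t k := by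
      intro k
      have := hl k
      rw [hgt, hgt, List.map_cons] at this
      exact List.cons.inj this
    obtain ⟨G, hG⟩ := exists_guarded g (fun k => (hl' k).1)
    obtain ⟨L, hL⟩ := ih t (fun k => (hl' k).2) (fun k => by
      have := hlen k
      rw [hgt k, List.length_cons] at this
      omega)
    exact ⟨G :: L, fun k => by rw [List.map_cons, hG, hL, hgt]⟩

theorem fold_surjective {V : Type} (P : Proc V) : ∃ l : Layer Proc V, fold l = P := by
  have key : ∀ q : ∀ k, Layer (Approx k) V, (∀ k, (q (k + 1)).map (Approx.trunc k) = q k) →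
      ∃ l : Layer Proc V, ∀ k, l.map (approx k) = q k := by
    intro q hq
    cases h0 : q 0 with
    | par P Q =>
      have h : ∀ k, ∃ P Q, q k = .par P Q := by
        intro k
        induction k with
        | zero => exact ⟨P, Q, h0⟩
        | succ k ih =>
          obtain ⟨P, Q, hPQ⟩ := ih
          have := hq k
          cases hk : q (k + 1) <;> simp_all [Layer.map]
      choose p p' hp using h
      have hpp : ∀ k, Approx.trunc k V (p (k + 1)) = p k ∧
          Approx.trunc k V (p' (k + 1)) = p' k := by
        intro k
        have := hq k
        rw [hp, hp] at this
        exact Layer.par.inj this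
      exact ⟨.par ⟨p, fun k => (hpp k).1⟩ ⟨p', fun k => (hpp k).2⟩, fun k => (hp k).symm⟩
    | sum gs =>
      have h : ∀ k, ∃ gs, q k = .sum gs := by
        intro k
        induction k with
        | zero => exact ⟨gs, h0⟩
        | succ k ih =>
          obtain ⟨gs', hgs'⟩ := ih
          have := hq k
          cases hk : q (k + 1) <;> simp_all [Layer.map]
      choose l hl using h
      obtain ⟨L, hL⟩ := exists_list _ l rfl (fun k => by
        have := hq k
        rw [hl, hl] at this
        exact Layer.sum.inj this)
      exact ⟨.sum L, fun k => by rw [hl, ← hL, Layer.map]⟩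
  obtain ⟨l, hl⟩ := key (fun k => P.1 (k + 1)) (fun k => P.2 (k + 1))
  refine ⟨l, Subtype.ext (funext fun k => ?_)⟩
  cases k with
  | zero => rfl
  | succ k => exact hl k

/-- The outermost layer of a process (a right inverse of `fold`). -/
noncomputable def unfold {V : Type} (P : Proc V) : Layer Proc V :=
  (fold_surjective P).choose

theorem fold_unfold {V : Type} (P : Proc V) : fold (unfold P) = P :=
  (fold_surjective P).choose_spec

end Proc

/-! ### Graphs with testing and fair testing equivalence -/

/-- The two edges of the one-vertex alphabet: the identity `τ` and the success action `♡`. -/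
inductive Label : Type
  | tau
  | tick

/-- Reflexive graphs over the one-vertex alphabet; `Step x α y` is a transition from `x`
to `y` labelled `α`, and identity edges lie over `τ`. -/
structure TransitionGraph where
  Obj : Type*
  Step : Obj → Label → Obj → Prop
  step_refl : ∀ x, Step x .tau x

namespace TransitionGraph

variable (G : TransitionGraph)

/-- Finite sequences of silent transitions. -/
def Silent : G.Obj → G.Obj → Prop :=
  Relation.ReflTransGen (fun x y => G.Step x .tau y)

/-- Weak transitions: silent sequences, over `♡` interspersed with exactly one `♡`. -/
def Weak (x : G.Obj) : Label → G.Obj → Prop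
  | .tau, y => G.Silent x y
  | .tick, y => ∃ u v, G.Silent x u ∧ G.Step u .tick v ∧ G.Silent v y

/-- Weak bisimulations on a transition graph. -/
def IsWeakBisimulation (R : G.Obj → G.Obj → Prop) : Prop :=
  ∀ x y, R x y →
    (∀ α x', G.Step x α x' → ∃ y', G.Weak y α y' ∧ R x' y') ∧
    (∀ α y', G.Step y α y' → ∃ x', G.Weak x α x' ∧ R x' y')

/-- Weak bisimilarity. -/
def WeakBisimilar (x y : G.Obj) : Prop :=
  ∃ R, G.IsWeakBisimulation R ∧ R x y

theorem WeakBisimilar.refl (x : G.Obj) : G.WeakBisimilar x x := by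
  have hw : ∀ (α : Label) (a b : G.Obj), G.Step a α b → G.Weak a α b := by
    intro α a b h
    cases α with
    | tau => exact Relation.ReflTransGen.single h
    | tick => exact ⟨a, b, Relation.ReflTransGen.refl, h, Relation.ReflTransGen.refl⟩
  refine ⟨Eq, ?_, rfl⟩
  rintro a _ rfl
  exact ⟨fun α a' h => ⟨a', hw _ _ _ h, rfl⟩, fun α a' h => ⟨a', hw _ _ _ h, rfl⟩⟩

/-- The fair testing pole `⊥`: whatever silent sequence is performed, a weak `♡` transition
remains possible. -/
def Pole (x : G.Obj) : Prop :=
  ∀ y, G.Weak x .tau y → ∃ z, G.Weak y .tick z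

end TransitionGraph

/-- (Free) graphs with testing. -/
structure TestingGraph extends TransitionGraph where
  /-- `Test x y z` : `z` is a parallel composition of `x` and `y`. -/
  Test : Obj → Obj → Obj → Prop
  test_equivalence : Equivalence (fun x y => ∃ z, Test x y z)
  test_functional : ∀ x y z z', Test x y z → Test x y z' →
    toTransitionGraph.WeakBisimilar z z'

namespace TestingGraph

/-- `x` and `y` may be tested against each other. -/
def Coh (G : TestingGraph) (x y : G.Obj) : Prop := ∃ z, G.Test x y z

/-- Fair testing equivalence. -/
def FairEquiv (G : TestingGraph) (x y : G.Obj) : Prop :=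
  G.Coh x y ∧ ∀ z, G.Coh z x →
    ((∃ u, G.Test x z u ∧ G.Pole u) ↔ (∃ v, G.Test y z v ∧ G.Pole v))

/-- A map is intensionally fully abstract (for fair testing equivalence) if it preserves and
reflects fair testing equivalence and is surjective up to fair testing equivalence. -/
def IntensionallyFullyAbstract (G H : TestingGraph) (f : G.Obj → H.Obj) : Prop :=
  (∀ x y, G.FairEquiv x y ↔ H.FairEquiv (f x) (f y)) ∧
  ∀ y, ∃ x, H.FairEquiv (f x) y

end TestingGraph

/-! ### Pairs of a finite set of channels and a finite multiset over it -/

/-- `⟨γ ∥ S⟩`: a finite set `γ` of channels with a finite multiset of elements of `F γ`. -/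
structure Soup (F : Type → Type*) where
  chan : Finset ℕ
  items : Multiset (F chan)

/-- `⟨γ ∥ S⟩ @ ⟨γ' ∥ S'⟩` is `⟨γ ∥ S ∪ S'⟩` if `γ = γ'`, and undefined otherwise. -/
inductive Soup.At {F : Type → Type*} : Soup F → Soup F → Soup F → Prop
  | mk (γ : Finset ℕ) (S S' : Multiset (F γ)) : At ⟨γ, S⟩ ⟨γ, S'⟩ ⟨γ, S + S'⟩

theorem Soup.at_equivalence {F : Type → Type*} :
    Equivalence (fun C C' : Soup F => ∃ D, Soup.At C C' D) where
  refl C := ⟨_, .mk C.chan C.items C.items⟩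
  symm := by
    rintro _ _ ⟨_, ⟨γ, S, S'⟩⟩
    exact ⟨_, .mk γ S' S⟩
  trans := by
    rintro _ _ _ ⟨_, ⟨γ, S, S'⟩⟩ ⟨_, h⟩
    cases h with
    | mk _ _ S'' => exact ⟨_, .mk γ S S''⟩

theorem Soup.at_functional {F : Type → Type*} {C C' D D' : Soup F}
    (h : Soup.At C C' D) (h' : Soup.At C C' D') : D = D' := by
  cases h
  cases h'
  rfl

/-- The inclusion of channels `γ ⊆ γ'`. -/
def incl {γ γ' : Finset ℕ} (h : γ ⊆ γ') : γ → γ' := fun a => ⟨a.1, h a.2⟩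

/-- Extend a map `V → γ` to `Option V → γ, a` by sending the extra element to `a`. -/
def addName {γ : Finset ℕ} {V : Type} (σ : V → γ) (a : ℕ) :
    Option V → (insert a γ : Finset ℕ)
  | none => ⟨a, Finset.mem_insert_self a γ⟩
  | some x => ⟨(σ x).1, Finset.mem_insert_of_mem (σ x).2⟩

/-! ### Configurations of the π-calculus -/

/-- Configurations `⟨γ ∥ P₁, …, Pₙ⟩`. -/
abbrev Conf : Type := Soup Proc

/-- Reduction of configurations. A sum `g +ₕ R` in which `g` is one of the summands is written
as a list containing `g`. -/
inductive Conf.Step : Conf → Label → Conf → Prop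
  | refl (C : Conf) : Step C .tau C
  | heat (γ : Finset ℕ) (P Q : Proc γ) :
      Step ⟨γ, {Proc.par P Q}⟩ .tau ⟨γ, {P, Q}⟩
  | tau (γ : Finset ℕ) (gs : List (Guarded Proc γ)) (P : Proc γ) (hP : .tau P ∈ gs) :
      Step ⟨γ, {Proc.sum gs}⟩ .tau ⟨γ, {P}⟩
  | tick (γ : Finset ℕ) (gs : List (Guarded Proc γ)) (P : Proc γ) (hP : .tick P ∈ gs) :
      Step ⟨γ, {Proc.sum gs}⟩ .tick ⟨γ, {P}⟩
  | nu (γ : Finset ℕ) (gs : List (Guarded Proc γ)) (P : Proc (Option γ)) (hP : .nu P ∈ gs)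
      (a : ℕ) (ha : a ∉ γ) :
      Step ⟨γ, {Proc.sum gs}⟩ .tau ⟨insert a γ, {P.subst (addName id a)}⟩
  | sync (γ : Finset ℕ) (gs gs' : List (Guarded Proc γ)) (a c : γ)
      (P : Proc (Option γ)) (Q : Proc γ) (hP : .inp a P ∈ gs) (hQ : .out a c Q ∈ gs') :
      Step ⟨γ, {Proc.sum gs, Proc.sum gs'}⟩ .tau
        ⟨γ, {P.subst (fun x => x.getD c), Q}⟩
  | ctx (γ₁ γ₂ : Finset ℕ) (h : γ₁ ⊆ γ₂) (S S₁ : Multiset (Proc γ₁)) (S₂ : Multiset (Proc γ₂))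
      (α : Label) (hS : Step ⟨γ₁, S₁⟩ α ⟨γ₂, S₂⟩) :
      Step ⟨γ₁, S + S₁⟩ α ⟨γ₂, S.map (Proc.subst (incl h)) + S₂⟩

/-- The graph with testing of π-calculus configurations. -/
def confGraph : TestingGraph where
  Obj := Conf
  Step := Conf.Step
  step_refl := .refl
  Test := Soup.At
  test_equivalence := Soup.at_equivalence
  test_functional _ _ _ _ h h' := by
    rw [Soup.at_functional h h']
    exact TransitionGraph.WeakBisimilar.refl _ _

/-! ### Views and behaviours -/

/-- `Basic n m`: basic actions from an individual `[n]` (an agent knowing `n` channels),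
following a single agent, which knows `m` channels afterwards. -/
inductive Basic : ℕ → ℕ → Type
  /-- left branch of a fork -/
  | forkL {n : ℕ} : Basic n n
  /-- right branch of a fork -/
  | forkR {n : ℕ} : Basic n n
  | tau {n : ℕ} : Basic n n
  | tick {n : ℕ} : Basic n n
  /-- channel creation; the new channel is the last one -/
  | nu {n : ℕ} : Basic n (n + 1)
  /-- input on `a`; the received channel is the last one -/
  | inp {n : ℕ} (a : Fin n) : Basic n (n + 1)
  /-- output of `b` on `a` -/
  | out {n : ℕ} (a b : Fin n) : Basic n n

/-- Views: composites of basic actions, the earliest one first. -/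
inductive View : ℕ → ℕ → Type
  | nil {n : ℕ} : View n n
  | cons {n k m : ℕ} (b : Basic n k) (v : View k m) : View n m

namespace View

/-- Vertical composition of views. -/
def comp : ∀ {n m k : ℕ}, View n m → View m k → View n k
  | _, _, _, nil, w => w
  | _, _, _, cons b v, w => cons b (comp v w)

theorem comp_nil : ∀ {n m : ℕ} (v : View n m), v.comp nil = v
  | _, _, nil => rfl
  | _, _, cons b v => congrArg (cons b) (comp_nil v)

theorem comp_assoc : ∀ {n m k l : ℕ} (u : View n m) (v : View m k) (w : View k l),
    (u.comp v).comp w = u.comp (v.comp w)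
  | _, _, _, _, nil, _, _ => rfl
  | _, _, _, _, cons b u, v, w => congrArg (cons b) (comp_assoc u v w)

end View

/-- Objects of the category of views on the individual `[n]`. -/
structure ViewOn (n : ℕ) where
  tgt : ℕ
  view : View n tgt

/-- A morphism `u ⟶ u'` of views is a way of extending `u` to `u'`. -/
instance (n : ℕ) : Category (ViewOn n) where
  Hom u u' := {w : View u.tgt u'.tgt // u.view.comp w = u'.view}
  id u := ⟨.nil, u.view.comp_nil⟩
  comp f g := ⟨f.1.comp g.1, by rw [← View.comp_assoc, f.2, g.2]⟩
  id_comp _ := rfl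
  comp_id f := Subtype.ext f.1.comp_nil
  assoc f g h := Subtype.ext (View.comp_assoc f.1 g.1 h.1)

/-- The identity view. -/
def ViewOn.root (n : ℕ) : ViewOn n := ⟨n, .nil⟩

/-- The unique morphism from the identity view. -/
def ViewOn.fromRoot {n : ℕ} (v : ViewOn n) : ViewOn.root n ⟶ v := ⟨v.view, rfl⟩

/-- Precomposing views with a basic action. -/
def ViewOn.prefixing {n m : ℕ} (b : Basic n m) : ViewOn m ⥤ ViewOn n where
  obj v := ⟨v.tgt, .cons b v.view⟩
  map f := ⟨f.1, congrArg (View.cons b) f.2⟩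

/-- Behaviours on `[n]`: presheaves of finite sets on the category of views on `[n]`. -/
structure Behaviour (n : ℕ) where
  presheaf : (ViewOn n)ᵒᵖ ⥤ Type
  finite : ∀ v, Finite (presheaf.obj v)

namespace Behaviour

variable {n : ℕ}

/-- The initial states of a behaviour. -/
abbrev States (B : Behaviour n) : Type := B.presheaf.obj (op (ViewOn.root n))

/-- A behaviour is definite if it has exactly one initial state. -/
def IsDefinite (B : Behaviour n) : Prop := Nonempty (Unique B.States)

/-- The residual `B · b` of a behaviour after a basic action. -/
def residual (B : Behaviour n) {m : ℕ} (b : Basic n m) : Behaviour m where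
  presheaf := (ViewOn.prefixing b).op ⋙ B.presheaf
  finite v := B.finite (op ((ViewOn.prefixing b).obj v.unop))

/-- The subpresheaf of the states lying above a given initial state. -/
def above (B : Behaviour n) (i : B.States) : Subfunctor B.presheaf where
  obj v := {s | B.presheaf.map v.unop.fromRoot.op s = i}
  map {u v} f s hs := by
    change B.presheaf.map v.unop.fromRoot.op (B.presheaf.map f s) = i
    rw [← Functor.map_comp_apply]
    have : f ≫ v.unop.fromRoot.op = u.unop.fromRoot.op := by
      apply Quiver.Hom.unop_inj
      apply Subtype.ext
      exact f.unop.2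
    rw [this]
    exact hs

/-- The restriction `B|ᵢ` of a behaviour to an initial state `i`. -/
def restrict (B : Behaviour n) (i : B.States) : Behaviour n where
  presheaf := (B.above i).toFunctor
  finite v := by
    have := B.finite v
    exact Subtype.finite

theorem restrict_isDefinite (B : Behaviour n) (i : B.States) : (B.restrict i).IsDefinite := by
  have hid : (ViewOn.root n).fromRoot.op = 𝟙 (op (ViewOn.root n)) := rfl
  have key : ∀ s : B.States,
      B.presheaf.map (ViewOn.root n).fromRoot.op s = s := by
    intro s
    rw [hid]
    exact B.presheaf.map_id_apply _ _
  exact ⟨⟨⟨⟨i, key i⟩⟩, fun s => Subtype.ext ((key s.1).symm.trans s.2)⟩⟩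

end Behaviour

/-- Definite behaviours on `[n]`. -/
def Definite (n : ℕ) : Type 1 := {B : Behaviour n // B.IsDefinite}

/-- The initial states of `D · b`. -/
abbrev Definite.StatesAfter {n m : ℕ} (D : Definite n) (b : Basic n m) : Type :=
  (D.1.residual b).States

/-- The definite behaviour `(D · b)|ᵢ`. -/
def Definite.after {n m : ℕ} (D : Definite n) (b : Basic n m) (i : D.StatesAfter b) :
    Definite m :=
  ⟨(D.1.residual b).restrict i, (D.1.residual b).restrict_isDefinite i⟩

/-! ### Coinductive definition of definite behaviours -/

section Corec

variable {X : ℕ → Type*} (c : ∀ n m : ℕ, X n → Basic n m → List (X m))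

/-- States over a view of the definite behaviour generated by `x`. -/
def CorecState : ∀ {n m : ℕ}, View n m → X n → Type
  | _, _, .nil, _ => Unit
  | _, _, .cons b w, x => Σ i : Fin (c _ _ x b).length, CorecState w ((c _ _ x b).get i)

/-- The state over `b :: v` given by a choice `i` of a seed and a state `s` over `v`. -/
def CorecState.mk {n k m : ℕ} (b : Basic n k) (v : View k m) (x : X n)
    (i : Fin (c _ _ x b).length) (s : CorecState c v ((c _ _ x b).get i)) :
    CorecState c (.cons b v) x := ⟨i, s⟩

/-- Restriction of states to a prefix. -/
def CorecState.restr : ∀ {n m k : ℕ} (v : View n m) (w : View m k) (x : X n),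
    CorecState c (v.comp w) x → CorecState c v x
  | _, _, _, .nil, _, _ => fun _ => ()
  | _, _, _, .cons b v, w, x =>
    fun s : Σ i : Fin (c _ _ x b).length, CorecState c (v.comp w) ((c _ _ x b).get i) =>
      CorecState.mk c b v x s.1 (CorecState.restr v w _ s.2)

theorem CorecState.finite : ∀ {n m : ℕ} (v : View n m) (x : X n), Finite (CorecState c v x)
  | _, _, .nil, _ => inferInstanceAs (Finite Unit)
  | _, _, .cons b w, x => by
    have := fun i : Fin (c _ _ x b).length => CorecState.finite w ((c _ _ x b).get i)
    exact inferInstanceAs (Finite (Σ i : Fin (c _ _ x b).length, _))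

/-- Restriction of states along a morphism of views. -/
def CorecState.restrHom {n : ℕ} {u v : ViewOn n} (f : u ⟶ v) (x : X n)
    (s : CorecState c v.view x) : CorecState c u.view x :=
  CorecState.restr c u.view f.1 x (cast (congrArg (fun t => CorecState c t x) f.2.symm) s)

theorem CorecState.cast_mk {n k m : ℕ} (b : Basic n k) (v t : View k m) (x : X n)
    (i : Fin (c _ _ x b).length) (s : CorecState c v ((c _ _ x b).get i)) (ht : v = t)
    (e : CorecState c (.cons b v) x = CorecState c (.cons b t) x) :
    cast e (CorecState.mk c b v x i s) = CorecState.mk c b t x i (cast (by rw [ht]) s) := by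
  subst ht
  rfl

theorem CorecState.restr_nil : ∀ {n m : ℕ} (v : View n m) (x : X n) (s : CorecState c v x)
    (e : CorecState c v x = CorecState c (v.comp .nil) x),
    CorecState.restr c v .nil x (cast e s) = s
  | _, _, .nil, _, _, _ => rfl
  | _, _, .cons b v, x, s, e => by
    obtain ⟨i, s⟩ := s
    refine (congrArg (CorecState.restr c (.cons b v) .nil x)
      (CorecState.cast_mk c b v (v.comp .nil) x i s v.comp_nil.symm e)).trans ?_
    exact congrArg (CorecState.mk c b v x i) (CorecState.restr_nil v _ s _)

theorem CorecState.restr_comp : ∀ {n m k l : ℕ} (u : View n m) (v : View m k) (w : View k l)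
    (x : X n) (s : CorecState c ((u.comp v).comp w) x)
    (e : CorecState c ((u.comp v).comp w) x = CorecState c (u.comp (v.comp w)) x),
    CorecState.restr c u (v.comp w) x (cast e s) =
      CorecState.restr c u v x (CorecState.restr c (u.comp v) w x s)
  | _, _, _, _, .nil, _, _, _, _, _ => rfl
  | _, _, _, _, .cons b u, v, w, x, s, e => by
    obtain ⟨i, s⟩ := s
    refine (congrArg (CorecState.restr c (.cons b u) (v.comp w) x)
      (CorecState.cast_mk c b ((u.comp v).comp w) (u.comp (v.comp w)) x i s
        (View.comp_assoc u v w) e)).trans ?_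
    exact congrArg (CorecState.mk c b u x i) (CorecState.restr_comp u v w _ s _)

/-- Given, for each seed `x : X n` and each basic action `b` from `[n]`, a finite list
`c x b` of seeds, this is the definite behaviour `⟦x⟧` determined by
`⟦x⟧ · b = ∑_{y ∈ c x b} ⟦y⟧`, where `∑` is the coproduct of behaviours. -/
def Definite.corec {n : ℕ} (x : X n) : Definite n :=
  ⟨{ presheaf :=
      { obj := fun v => CorecState c v.unop.view x
        map := fun f => TypeCat.ofHom (CorecState.restrHom c f.unop x)
        map_id := fun v => by
          refine ConcreteCategory.hom_ext _ _ fun s => ?_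
          exact CorecState.restr_nil c _ x s _
        map_comp := by
          rintro ⟨⟨_, u⟩⟩ ⟨⟨_, v⟩⟩ ⟨⟨_, w⟩⟩ ⟨⟨f, hf⟩⟩ ⟨⟨g, hg⟩⟩
          simp only at f g hf hg
          subst hg
          subst hf
          refine ConcreteCategory.hom_ext _ _ fun s => ?_
          exact CorecState.restr_comp c _ _ _ x s _ }
     finite := fun v => CorecState.finite c v.unop.view x },
   ⟨(inferInstance : Unique Unit)⟩⟩

end Corec

/-! ### Interpretation of processes -/

/-- The bijection `h' : γ, b ≃ n + 1` extending `h` by sending the new channel to the last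
element. -/
def extendBij {V : Type} {n : ℕ} (h : V ≃ Fin n) : Option V ≃ Fin (n + 1) :=
  h.optionCongr.trans finSuccEquivLast.symm

/-- A process together with a bijection from its free channels to `{0, …, n - 1}`. -/
structure NumberedProc (n : ℕ) where
  V : Type
  proc : Proc V
  bij : V ≃ Fin n

/-- `⟦g⟧ₕ · b` for a guarded process `g` is either empty or the interpretation of the
continuation. -/
def Guarded.next {V : Type} {n : ℕ} (h : V ≃ Fin n) :
    ∀ {m : ℕ}, Guarded Proc V → Basic n m → List (NumberedProc m)
  | _, .nu P, .nu => [⟨Option V, P, extendBij h⟩]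
  | _, .tick P, .tick => [⟨V, P, h⟩]
  | _, .tau P, .tau => [⟨V, P, h⟩]
  | _, .inp a P, .inp a' => if h a = a' then [⟨Option V, P, extendBij h⟩] else []
  | _, .out a b P, .out a' b' => if h a = a' ∧ h b = b' then [⟨V, P, h⟩] else []
  | _, _, _ => []

/-- `⟦P ∣ Q⟧ₕ = ⟨πˡ ↦ ⟦P⟧ₕ, πʳ ↦ ⟦Q⟧ₕ⟩`, and the interpretation of a sum is the definite sum
of the interpretations of its summands. -/
def Layer.next {V : Type} {n : ℕ} (h : V ≃ Fin n) :
    ∀ {m : ℕ}, Layer Proc V → Basic n m → List (NumberedProc m)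
  | _, .sum gs, b => gs.flatMap (fun g => g.next h b)
  | _, .par P _, .forkL => [⟨V, P, h⟩]
  | _, .par _ Q, .forkR => [⟨V, Q, h⟩]
  | _, .par _ _, _ => []

/-- The interpretation `⟦P⟧ₕ` of a process as a definite behaviour. -/
noncomputable def interp {V : Type} {n : ℕ} (P : Proc V) (h : V ≃ Fin n) : Definite n :=
  Definite.corec (fun _ _ (x : NumberedProc _) b => x.proc.unfold.next x.bij b)
    (⟨V, P, h⟩ : NumberedProc n)

/-! ### Mixed behaviours -/

/-- `D[σ]`: a definite behaviour on some `[n]` with a map from `{0, …, n - 1}` to channels. -/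
structure Located (V : Type) where
  n : ℕ
  beh : Definite n
  sub : Fin n → V

/-- Postcompose the substitution with a map of channels. -/
def Located.rename {V W : Type} (f : V → W) (x : Located V) : Located W :=
  ⟨x.n, x.beh, f ∘ x.sub⟩

/-- Mixed behaviours `⟨γ ∥ D₁[σ₁], …, Dₚ[σₚ]⟩`. -/
abbrev Mixed : Type 1 := Soup Located

/-- `σ + ⌜a⌝ : n + 1 → γ, a`. -/
def addLast {γ : Finset ℕ} {n : ℕ} (σ : Fin n → γ) (a : ℕ) :
    Fin (n + 1) → (insert a γ : Finset ℕ) :=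
  Fin.snoc (α := fun _ => (insert a γ : Finset ℕ))
    (fun i => incl (Finset.subset_insert a γ) (σ i)) ⟨a, Finset.mem_insert_self a γ⟩

/-- Transitions of mixed behaviours. -/
inductive Mixed.Step : Mixed → Label → Mixed → Prop
  | refl (M : Mixed) : Step M .tau M
  | fork (γ : Finset ℕ) (n : ℕ) (D : Definite n) (σ : Fin n → γ)
      (i : D.StatesAfter .forkL) (j : D.StatesAfter .forkR) :
      Step ⟨γ, {⟨n, D, σ⟩}⟩ .tau ⟨γ, {⟨n, D.after .forkL i, σ⟩, ⟨n, D.after .forkR j, σ⟩}⟩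
  | tau (γ : Finset ℕ) (n : ℕ) (D : Definite n) (σ : Fin n → γ) (i : D.StatesAfter .tau) :
      Step ⟨γ, {⟨n, D, σ⟩}⟩ .tau ⟨γ, {⟨n, D.after .tau i, σ⟩}⟩
  | tick (γ : Finset ℕ) (n : ℕ) (D : Definite n) (σ : Fin n → γ) (i : D.StatesAfter .tick) :
      Step ⟨γ, {⟨n, D, σ⟩}⟩ .tick ⟨γ, {⟨n, D.after .tick i, σ⟩}⟩
  | nu (γ : Finset ℕ) (n : ℕ) (D : Definite n) (σ : Fin n → γ) (i : D.StatesAfter .nu)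
      (a : ℕ) (ha : a ∉ γ) :
      Step ⟨γ, {⟨n, D, σ⟩}⟩ .tau ⟨insert a γ, {⟨n + 1, D.after .nu i, addLast σ a⟩}⟩
  | sync (γ : Finset ℕ) (n₁ n₂ : ℕ) (D₁ : Definite n₁) (D₂ : Definite n₂)
      (σ₁ : Fin n₁ → γ) (σ₂ : Fin n₂ → γ) (a₁ : Fin n₁) (a₂ b₂ : Fin n₂)
      (i : D₁.StatesAfter (.inp a₁)) (j : D₂.StatesAfter (.out a₂ b₂)) (h : σ₁ a₁ = σ₂ a₂) :
      Step ⟨γ, {⟨n₁, D₁, σ₁⟩, ⟨n₂, D₂, σ₂⟩}⟩ .tau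
        ⟨γ, {⟨n₁ + 1, D₁.after (.inp a₁) i, Fin.snoc (α := fun _ => γ) σ₁ (σ₂ b₂)⟩,
          ⟨n₂, D₂.after (.out a₂ b₂) j, σ₂⟩}⟩
  | ctx (γ₁ γ₂ : Finset ℕ) (h : γ₁ ⊆ γ₂) (S S₁ : Multiset (Located γ₁))
      (S₂ : Multiset (Located γ₂)) (α : Label) (hS : Step ⟨γ₁, S₁⟩ α ⟨γ₂, S₂⟩) :
      Step ⟨γ₁, S + S₁⟩ α ⟨γ₂, S.map (Located.rename (incl h)) + S₂⟩

/-- The graph with testing of mixed behaviours. -/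
def mixedGraph : TestingGraph where
  Obj := Mixed
  Step := Mixed.Step
  step_refl := .refl
  Test := Soup.At
  test_equivalence := Soup.at_equivalence
  test_functional _ _ _ _ h h' := by
    rw [Soup.at_functional h h']
    exact TransitionGraph.WeakBisimilar.refl _ _

/-- The bijection `h_γ` from `γ` to its cardinal given by the order of natural numbers. -/
def orderBij (γ : Finset ℕ) : γ ≃ Fin γ.card := (γ.orderIsoOfFin rfl).symm.toEquiv

/-- The translation `⟨γ ∥ P₁, …, Pₙ⟩ ↦ ⟨γ ∥ ⟦P₁⟧[h_γ⁻¹], …, ⟦Pₙ⟧[h_γ⁻¹]⟩`, where each `⟦Pᵢ⟧` is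
taken with respect to `h_γ`. -/
noncomputable def translation (C : Conf) : Mixed :=
  ⟨C.chan, C.items.map (fun P =>
    ⟨C.chan.card, interp P (orderBij C.chan), (orderBij C.chan).symm⟩)⟩

end PiFair

/-! A process and its interpretation have the same continuations along every action, so they should
be weakly bisimilar, and the pole only depends on weak transitions. Two things prevent a direct
comparison. A residual of an interpretation is the interpretation of a continuation only up to
isomorphism. Moreover, a definite behaviour may have states along fork branches and along other
actions at once, whereas a process is either a sum or a parallel composition; a fork inside a sum
must be encoded by a guard `τ. (P ∣ Q)`, which needs two reductions where the behaviour needs one.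

Both are absorbed by `Matches`, the largest relation between processes and located behaviours `D[σ]`
that agree layer by layer, where a summand `τ. (P ∣ Q)` may stand for a pair of fork states. It is
stable under arbitrary substitutions (`Matches.subst`), it relates each process to its
interpretation (`matches_interp`), and every located behaviour has a matching process
(`matches_toProc`), a finite sum because behaviours have finitely many states. `Cover` extends it to
multisets, letting a parallel composition not yet split account for two behaviours. The resulting
relation `Related` is a weak bisimulation, so it preserves and reflects the pole
(`Related.pole_iff`).

Covers add up, so the comparison survives the addition of a test. Tests are carried from
configurations to mixed behaviours by `translation` and back by `Located.toProc`, which yields full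
abstraction; surjectivity up to fair testing holds because `translation` of the matching processes
and the given mixed behaviour are covered by the same configuration. -/

namespace PiFair

/-! ### Processes as a final coalgebra: injectivity of `fold`, and substitution. -/

namespace Proc

theorem ext_approx {V : Type} {P Q : Proc V} (h : ∀ k, approx k V P = approx k V Q) : P = Q :=
  Subtype.ext (funext h)

end Proc

theorem Guarded.eq_of_map_approx {V : Type} {g g' : Guarded Proc V}
    (h : ∀ k, g.map (Proc.approx k) = g'.map (Proc.approx k)) : g = g' := by
  cases g <;> cases g' <;> simp only [Guarded.map, Guarded.nu.injEq, Guarded.tick.injEq,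
    Guarded.tau.injEq, Guarded.inp.injEq, Guarded.out.injEq, reduceCtorEq, forall_const,
    forall_and] at h ⊢
  all_goals first
    | exact Proc.ext_approx h
    | exact ⟨h.1, Proc.ext_approx h.2⟩
    | exact ⟨h.1, h.2.1, Proc.ext_approx h.2.2⟩

theorem Guarded.list_eq_of_map_approx {V : Type} : ∀ {gs gs' : List (Guarded Proc V)},
    (∀ k, gs.map (Guarded.map (Proc.approx k)) = gs'.map (Guarded.map (Proc.approx k))) →
    gs = gs'
  | [], [], _ => rfl
  | [], _ :: _, h => by simpa using h 0
  | _ :: _, [], h => by simpa using h 0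
  | g :: gs, g' :: gs', h => by
    simp only [List.map_cons, List.cons.injEq, forall_and] at h
    rw [Guarded.eq_of_map_approx h.1, Guarded.list_eq_of_map_approx h.2]

theorem Layer.eq_of_map_approx {V : Type} {l l' : Layer Proc V}
    (h : ∀ k, l.map (Proc.approx k) = l'.map (Proc.approx k)) : l = l' := by
  cases l <;> cases l' <;> simp only [Layer.map, Layer.sum.injEq, Layer.par.injEq,
    reduceCtorEq, forall_const, forall_and] at h ⊢
  · exact Guarded.list_eq_of_map_approx h
  · exact ⟨Proc.ext_approx h.1, Proc.ext_approx h.2⟩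

namespace Proc

/-- At depth `k + 1`, `fold l` is by definition `l.map (approx k)`, and a layer is determined by
these images. This makes `unfold`, obtained by choice, a two-sided inverse, so interpretations can
be computed. -/
theorem fold_injective {V : Type} : Function.Injective (fold : Layer Proc V → Proc V) :=
  fun _ _ h => Layer.eq_of_map_approx fun k => congrArg (fun P => approx (k + 1) V P) h

@[simp] theorem unfold_fold {V : Type} (l : Layer Proc V) : unfold (fold l) = l :=
  fold_injective (fold_unfold _)

theorem sum_injective {V : Type} : Function.Injective (sum : List (Guarded Proc V) → Proc V) :=
  fun _ _ h => Layer.sum.inj (fold_injective h)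

theorem par_inj {V : Type} {P Q P' Q' : Proc V} (h : par P Q = par P' Q') : P = P' ∧ Q = Q' :=
  Layer.par.inj (fold_injective h)

theorem sum_ne_par {V : Type} (gs : List (Guarded Proc V)) (P Q : Proc V) : sum gs ≠ par P Q :=
  fun h => Layer.noConfusion rfl rfl (heq_of_eq (fold_injective h))

theorem eq_sum_or_par {V : Type} (P : Proc V) :
    (∃ gs, P = sum gs) ∨ ∃ P₁ P₂, P = par P₁ P₂ := by
  obtain ⟨l, rfl⟩ := fold_surjective P
  cases l with
  | sum gs => exact .inl ⟨gs, rfl⟩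
  | par P Q => exact .inr ⟨P, Q, rfl⟩

theorem subst_fold {V W : Type} (σ : V → W) (l : Layer Proc V) :
    (fold l).subst σ = fold (l.subst (fun _ _ => subst) σ) := by
  refine Subtype.ext (funext fun k => ?_)
  cases k with
  | zero => rfl
  | succ k =>
    exact (Layer.map_subst (approx k) (fun _ _ => subst) (Approx.subst k)
      (fun _ _ _ _ => rfl) σ l).symm

theorem subst_sum {V W : Type} (σ : V → W) (gs : List (Guarded Proc V)) :
    (sum gs).subst σ = sum (gs.map (Guarded.subst (fun _ _ => subst) σ)) :=
  subst_fold σ _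

theorem subst_par {V W : Type} (σ : V → W) (P Q : Proc V) :
    (par P Q).subst σ = par (P.subst σ) (Q.subst σ) :=
  subst_fold σ _

end Proc

theorem Approx.subst_id : ∀ (k : ℕ) (V : Type) (P : Approx k V), Approx.subst k V V id P = P
  | 0, _, _ => rfl
  | k + 1, V, P => by
    have hg : ∀ g : Guarded (Approx k) V, Guarded.subst (Approx.subst k) id g = g := by
      intro g; cases g <;> simp [Guarded.subst, Approx.subst_id k]
    change Layer.subst (Approx.subst k) id P = P
    cases P with
    | sum gs =>
      rw [Layer.subst, List.map_congr_left (fun g _ => hg g), List.map_id']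
    | par P Q => rw [Layer.subst, Approx.subst_id k, Approx.subst_id k]

theorem Proc.subst_id {V : Type} (P : Proc V) : P.subst id = P :=
  Subtype.ext (funext fun k => Approx.subst_id k V (P.1 k))

/-! ### Isomorphisms of behaviours, residuals and restrictions. -/

namespace Behaviour

variable {n : ℕ}

/-- Isomorphic behaviours have isomorphic residuals. -/
def residualIso {B B' : Behaviour n} (e : B.presheaf ≅ B'.presheaf) {m : ℕ} (b : Basic n m) :
    (B.residual b).presheaf ≅ (B'.residual b).presheaf :=
  Functor.isoWhiskerLeft (ViewOn.prefixing b).op e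

/-- Isomorphic behaviours have isomorphic restrictions to corresponding initial states. -/
def restrictIso {B B' : Behaviour n} (e : B.presheaf ≅ B'.presheaf) (i : B.States) :
    (B.restrict i).presheaf ≅ (B'.restrict (e.hom.app _ i)).presheaf :=
  NatIso.ofComponents (fun v => Equiv.toIso
    { toFun := fun s => ⟨e.hom.app v s.1, by
        have h := e.hom.naturality_apply v.unop.fromRoot.op s.1
        exact h.symm.trans (congrArg _ s.2)⟩
      invFun := fun s => ⟨e.inv.app v s.1, by
        have h := e.inv.naturality_apply v.unop.fromRoot.op s.1
        refine h.symm.trans ((congrArg _ s.2).trans ?_)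
        exact e.hom_inv_id_app_apply _ _⟩
      left_inv := fun s => Subtype.ext (e.hom_inv_id_app_apply _ _)
      right_inv := fun s => Subtype.ext (e.inv_hom_id_app_apply _ _) })
    (fun {u v} f => by
      refine ConcreteCategory.hom_ext _ _ fun s => ?_
      refine Subtype.ext ?_
      exact e.hom.naturality_apply f s.1)

end Behaviour

/-- Definite behaviours with isomorphic presheaves. -/
def Definite.Equivalent {n : ℕ} (D D' : Definite n) : Prop :=
  Nonempty (D.1.presheaf ≅ D'.1.presheaf)

theorem Definite.Equivalent.symm {n : ℕ} {D D' : Definite n} (h : D.Equivalent D') :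
    D'.Equivalent D :=
  h.map Iso.symm

theorem Definite.Equivalent.trans {n : ℕ} {D D' D'' : Definite n} (h : D.Equivalent D')
    (h' : D'.Equivalent D'') : D.Equivalent D'' :=
  ⟨h.some ≪≫ h'.some⟩

theorem Definite.Equivalent.exists_after {n m : ℕ} {D D' : Definite n} (h : D.Equivalent D')
    (b : Basic n m) (i : D.StatesAfter b) :
    ∃ j : D'.StatesAfter b, (D.after b i).Equivalent (D'.after b j) :=
  ⟨_, ⟨Behaviour.restrictIso (Behaviour.residualIso h.some b) i⟩⟩

/-! ### Residuals of corecursively defined behaviours and of interpretations. -/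

section Corec

variable {X : ℕ → Type*} (c : ∀ n m : ℕ, X n → Basic n m → List (X m))

theorem CorecState.restrHom_mk {n k : ℕ} (b : Basic n k) {u v : ViewOn k} (f : u ⟶ v) (x : X n)
    (i : Fin (c _ _ x b).length) (s : CorecState c v.view ((c _ _ x b).get i)) :
    CorecState.restrHom c ((ViewOn.prefixing b).map f) x (CorecState.mk c b v.view x i s) =
      CorecState.mk c b u.view x i (CorecState.restrHom c f _ s) := by
  obtain ⟨_, v⟩ := v
  obtain ⟨f, hf⟩ := f
  simp only at hf f
  subst hf
  rfl

/-- The initial state of `⟦x⟧ · b` corresponding to an element of the list of seeds. -/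
def Definite.corecState {n m : ℕ} (x : X n) (b : Basic n m) (i : Fin (c _ _ x b).length) :
    (Definite.corec c x).StatesAfter b :=
  CorecState.mk c b .nil x i ()

theorem Definite.corecState_surjective {n m : ℕ} (x : X n) (b : Basic n m) :
    Function.Surjective (Definite.corecState c x b) :=
  fun ⟨i, ()⟩ => ⟨i, rfl⟩

/-- States over `b :: v` are pairs of a seed index and a state over `v`, and restriction keeps the
index. The states above `i` are therefore a copy of those generated by the `i`-th seed, though not
literally the same sets. -/
theorem Definite.corec_after {n m : ℕ} (x : X n) (b : Basic n m) (i : Fin (c _ _ x b).length) :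
    ((Definite.corec c x).after b (Definite.corecState c x b i)).Equivalent
      (Definite.corec c ((c _ _ x b).get i)) := by
  refine Definite.Equivalent.symm ⟨NatIso.ofComponents (fun v => Equiv.toIso
    (Equiv.ofBijective (fun s => ⟨CorecState.mk c b v.unop.view x i s, ?_⟩) ⟨?_, ?_⟩)) ?_⟩
  · rfl
  · intro s t h
    have h := congrArg Subtype.val h
    exact eq_of_heq (Sigma.mk.inj h).2
  · rintro ⟨⟨j, s⟩, h⟩
    have h' : j = i := (Sigma.mk.inj h).1
    subst h'
    exact ⟨s, rfl⟩
  · intro u v f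
    refine ConcreteCategory.hom_ext _ _ fun s => ?_
    refine Subtype.ext ?_
    exact (CorecState.restrHom_mk c b f.unop x i s).symm

end Corec

/-- The continuations of a process along a basic action. -/
noncomputable def NumberedProc.next (n m : ℕ) (x : NumberedProc n) (b : Basic n m) :
    List (NumberedProc m) :=
  x.proc.unfold.next x.bij b

/-- The states of `⟦P⟧ₕ · b` are the continuations of `P` along `b`. -/
theorem interp_exists_next {V : Type} {n m : ℕ} (P : Proc V) (h : V ≃ Fin n) (b : Basic n m)
    (i : (interp P h).StatesAfter b) :
    ∃ x ∈ P.unfold.next h b, ((interp P h).after b i).Equivalent (interp x.proc x.bij) := by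
  obtain ⟨i, rfl⟩ := Definite.corecState_surjective _ _ _ i
  exact ⟨_, List.get_mem _ i, Definite.corec_after NumberedProc.next ⟨V, P, h⟩ b i⟩

theorem interp_exists_state {V : Type} {n m : ℕ} (P : Proc V) (h : V ≃ Fin n) (b : Basic n m)
    (x : NumberedProc m) (hx : x ∈ P.unfold.next h b) :
    ∃ i : (interp P h).StatesAfter b,
      ((interp P h).after b i).Equivalent (interp x.proc x.bij) := by
  obtain ⟨i, rfl⟩ := List.get_of_mem hx
  exact ⟨_, Definite.corec_after NumberedProc.next ⟨V, P, h⟩ b i⟩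

/-! ### Continuations of located behaviours. -/

namespace Located

variable {V W : Type}

/-- What becomes of `D[σ]` along a basic action that binds no channel. -/
def cont (L : Located V) (b : Basic L.n L.n) (i : L.beh.StatesAfter b) : Located V :=
  ⟨L.n, L.beh.after b i, L.sub⟩

/-- What becomes of `D[σ]` along a basic action that binds a channel. -/
def bind (L : Located V) (b : Basic L.n (L.n + 1)) (i : L.beh.StatesAfter b) :
    Located (Option V) :=
  ⟨L.n + 1, L.beh.after b i, Fin.snoc (α := fun _ => Option V) (some ∘ L.sub) none⟩

/-- Common source of the three ways of treating a bound channel: keeping it bound under a renaming,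
making it a fresh channel, and replacing it by a received channel. -/
theorem rename_bind {f : V → W} (g : Option V → W) (hg : ∀ v, g (some v) = f v)
    (L : Located V) (b : Basic L.n (L.n + 1)) (i : L.beh.StatesAfter b) :
    (L.bind b i).rename g =
      ⟨L.n + 1, L.beh.after b i, Fin.snoc (α := fun _ => W) (f ∘ L.sub) (g none)⟩ := by
  have : g ∘ (Fin.snoc (α := fun _ => Option V) (some ∘ L.sub) none) =
      Fin.snoc (α := fun _ => W) (f ∘ L.sub) (g none) := by
    funext x
    refine Fin.lastCases ?_ (fun x => ?_) x <;> simp [hg]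
  simp only [rename, bind, this]

theorem rename_bind_option (f : V → W) (L : Located V) (b : Basic L.n (L.n + 1))
    (i : L.beh.StatesAfter b) :
    (L.bind b i).rename (Option.map f) = (L.rename f).bind b i :=
  rename_bind (f := some ∘ f) _ (fun _ => rfl) L b i

theorem rename_bind_addName {γ : Finset ℕ} (a : ℕ) (L : Located γ) (b : Basic L.n (L.n + 1))
    (i : L.beh.StatesAfter b) :
    (L.bind b i).rename (addName id a) = ⟨L.n + 1, L.beh.after b i, addLast L.sub a⟩ :=
  rename_bind (f := incl (Finset.subset_insert a γ)) _ (fun _ => rfl) L b i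

theorem rename_bind_getD (c : V) (L : Located V) (b : Basic L.n (L.n + 1))
    (i : L.beh.StatesAfter b) :
    (L.bind b i).rename (fun x => x.getD c) =
      ⟨L.n + 1, L.beh.after b i, Fin.snoc (α := fun _ => V) L.sub c⟩ :=
  rename_bind (f := id) _ (fun _ => rfl) L b i

end Located

/-! ### Layerwise matching of processes and located behaviours. -/

/-- Relations between processes and located behaviours, for all sets of channels. -/
abbrev ItemRel : Type 1 := ∀ V : Type, Proc V → Located V → Prop

/-- A guarded process is accounted for by a state of a residual of `D[σ]`; a pair of states
along the two branches of a fork accounts for `τ. (P ∣ Q)`. -/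
def GuardMatch (A : ItemRel) {V : Type} (L : Located V) : Guarded Proc V → Prop
  | .nu P => ∃ i, A _ P (L.bind .nu i)
  | .tick P => ∃ i, A _ P (L.cont .tick i)
  | .tau P => (∃ i, A _ P (L.cont .tau i)) ∨ ∃ i j P₁ P₂, P = Proc.par P₁ P₂ ∧
      A _ P₁ (L.cont .forkL i) ∧ A _ P₂ (L.cont .forkR j)
  | .inp a P => ∃ a' i, L.sub a' = a ∧ A _ P (L.bind (.inp a') i)
  | .out a c P => ∃ a' c' i, L.sub a' = a ∧ L.sub c' = c ∧ A _ P (L.cont (.out a' c') i)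

/-- The guards of a sum correspond to the states of the residuals of `D[σ]`. -/
structure SumMatch (A : ItemRel) {V : Type} (gs : List (Guarded Proc V)) (L : Located V) :
    Prop where
  guard : ∀ g ∈ gs, GuardMatch A L g
  nu : ∀ i, ∃ P, .nu P ∈ gs ∧ A _ P (L.bind .nu i)
  tick : ∀ i, ∃ P, .tick P ∈ gs ∧ A _ P (L.cont .tick i)
  tau : ∀ i, ∃ P, .tau P ∈ gs ∧ A _ P (L.cont .tau i)
  inp : ∀ a i, ∃ P, .inp (L.sub a) P ∈ gs ∧ A _ P (L.bind (.inp a) i)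
  out : ∀ a c i, ∃ P, .out (L.sub a) (L.sub c) P ∈ gs ∧ A _ P (L.cont (.out a c) i)
  fork : ∀ i j, ∃ P Q, .tau (Proc.par P Q) ∈ gs ∧ A _ P (L.cont .forkL i) ∧
    A _ Q (L.cont .forkR j)

/-- The components of a parallel composition correspond to the states of `D[σ]` along the
branches of a fork, and `D[σ]` has no other states. -/
structure ParMatch (A : ItemRel) {V : Type} (P Q : Proc V) (L : Located V) : Prop where
  left_exists : Nonempty (L.beh.StatesAfter .forkL)
  right_exists : Nonempty (L.beh.StatesAfter .forkR)
  left : ∀ i, A _ P (L.cont .forkL i)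
  right : ∀ i, A _ Q (L.cont .forkR i)
  nu : IsEmpty (L.beh.StatesAfter .nu)
  tick : IsEmpty (L.beh.StatesAfter .tick)
  tau : IsEmpty (L.beh.StatesAfter .tau)
  inp : ∀ a, IsEmpty (L.beh.StatesAfter (.inp a))
  out : ∀ a c, IsEmpty (L.beh.StatesAfter (.out a c))

/-- A process and a located behaviour match in their first layer, up to `A` afterwards. -/
def LayerMatch (A : ItemRel) {V : Type} (P : Proc V) (L : Located V) : Prop :=
  (∃ gs, P = Proc.sum gs ∧ SumMatch A gs L) ∨ ∃ P₁ P₂, P = Proc.par P₁ P₂ ∧ ParMatch A P₁ P₂ L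

/-- Post-fixed points of layerwise matching. -/
def ItemRel.IsMatching (A : ItemRel) : Prop := ∀ V P L, A V P L → LayerMatch A P L

/-- The largest matching relation. -/
def Matches : ItemRel := fun V P L => ∃ A : ItemRel, A.IsMatching ∧ A V P L

theorem GuardMatch.mono {A B : ItemRel} (h : ∀ V P L, A V P L → B V P L) {V : Type}
    {L : Located V} {g : Guarded Proc V} (hg : GuardMatch A L g) : GuardMatch B L g := by
  cases g with
  | nu P => exact hg.imp fun _ => h _ _ _
  | tick P => exact hg.imp fun _ => h _ _ _
  | tau P =>
    exact hg.imp (Exists.imp fun _ => h _ _ _) fun ⟨i, j, P₁, P₂, e, h₁, h₂⟩ =>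
      ⟨i, j, P₁, P₂, e, h _ _ _ h₁, h _ _ _ h₂⟩
  | inp a P => exact hg.imp fun _ => Exists.imp fun _ => And.imp_right (h _ _ _)
  | out a c P =>
    exact hg.imp fun _ => Exists.imp fun _ => Exists.imp fun _ =>
      And.imp_right (And.imp_right (h _ _ _))

theorem SumMatch.mono {A B : ItemRel} (h : ∀ V P L, A V P L → B V P L) {V : Type}
    {gs : List (Guarded Proc V)} {L : Located V} (hg : SumMatch A gs L) : SumMatch B gs L where
  guard g hgs := (hg.guard g hgs).mono h
  nu i := (hg.nu i).imp fun _ => And.imp_right (h _ _ _)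
  tick i := (hg.tick i).imp fun _ => And.imp_right (h _ _ _)
  tau i := (hg.tau i).imp fun _ => And.imp_right (h _ _ _)
  inp a i := (hg.inp a i).imp fun _ => And.imp_right (h _ _ _)
  out a c i := (hg.out a c i).imp fun _ => And.imp_right (h _ _ _)
  fork i j := (hg.fork i j).imp fun _ => Exists.imp fun _ =>
    And.imp_right (And.imp (h _ _ _) (h _ _ _))

theorem ParMatch.mono {A B : ItemRel} (h : ∀ V P L, A V P L → B V P L) {V : Type}
    {P Q : Proc V} {L : Located V} (hp : ParMatch A P Q L) : ParMatch B P Q L :=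
  { hp with
    left := fun i => h _ _ _ (hp.left i)
    right := fun i => h _ _ _ (hp.right i) }

/-- Layerwise matching is monotone in the relation used for continuations, so the union of all its
post-fixed points is again one. -/
theorem Matches.layerMatch {V : Type} {P : Proc V} {L : Located V} (h : Matches V P L) :
    LayerMatch Matches P L := by
  obtain ⟨A, hA, h⟩ := h
  have hle : ∀ V P L, A V P L → Matches V P L := fun V P L h => ⟨A, hA, h⟩
  exact (hA _ _ _ h).imp
    (fun ⟨gs, e, h⟩ => ⟨gs, e, h.mono hle⟩) (fun ⟨P₁, P₂, e, h⟩ => ⟨P₁, P₂, e, h.mono hle⟩)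

theorem Matches.sumMatch {V : Type} {gs : List (Guarded Proc V)} {L : Located V}
    (h : Matches V (Proc.sum gs) L) : SumMatch Matches gs L := by
  obtain ⟨gs', e, h⟩ | ⟨P₁, P₂, e, h⟩ := h.layerMatch
  · exact Proc.sum_injective e ▸ h
  · exact absurd e (Proc.sum_ne_par _ _ _)

theorem Matches.parMatch {V : Type} {P Q : Proc V} {L : Located V}
    (h : Matches V (Proc.par P Q) L) : ParMatch Matches P Q L := by
  obtain ⟨gs', e, h⟩ | ⟨P₁, P₂, e, h⟩ := h.layerMatch
  · exact absurd e.symm (Proc.sum_ne_par _ _ _)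
  · obtain ⟨rfl, rfl⟩ := Proc.par_inj e
    exact h

/-- Matching is stable under substitution of channels. -/
theorem Matches.subst {V W : Type} (f : V → W) {P : Proc V} {L : Located V}
    (h : Matches V P L) : Matches W (P.subst f) (L.rename f) := by
  -- Coinduction on the closure of `Matches` under substitution. The source `V` and the map `f` are
  -- quantified inside `B` because passing under a binder turns `f` into `Option.map f`.
  let B : ItemRel := fun W P' L' => ∃ (V : Type) (f : V → W) (P : Proc V) (L : Located V),
    Matches V P L ∧ P.subst f = P' ∧ L.rename f = L'
  have hB : ∀ {V W : Type} (f : V → W) {P : Proc V} {L : Located V}, Matches V P L →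
      B W (P.subst f) (L.rename f) := fun f P L h => ⟨_, f, P, L, h, rfl, rfl⟩
  have hbind : ∀ {V W : Type} (f : V → W) {P : Proc (Option V)} {L : Located V}
      (b : Basic L.n (L.n + 1)) (i : L.beh.StatesAfter b), Matches _ P (L.bind b i) →
      B _ (P.subst (Option.map f)) ((L.rename f).bind b i) := fun f P L b i h =>
    ⟨_, Option.map f, P, _, h, rfl, L.rename_bind_option f b i⟩
  refine ⟨B, ?_, hB f h⟩
  clear h f P L V W
  rintro W _ _ ⟨V, f, P, L, hPL, rfl, rfl⟩
  obtain ⟨gs, rfl, h⟩ | ⟨P₁, P₂, rfl, h⟩ := hPL.layerMatch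
  · refine .inl ⟨_, Proc.subst_sum f gs, ?_, ?_, ?_, ?_, ?_, ?_, ?_⟩
    · intro g hg
      obtain ⟨g, hgs, rfl⟩ := List.mem_map.1 hg
      have h := h.guard g hgs
      cases g with
      | nu P => exact h.imp fun i => hbind f _ i
      | tick P => exact h.imp fun i => hB f
      | tau P =>
        refine h.imp (Exists.imp fun i => hB f) ?_
        rintro ⟨i, j, P₁, P₂, rfl, h₁, h₂⟩
        exact ⟨i, j, _, _, Proc.subst_par f _ _, hB f h₁, hB f h₂⟩
      | inp a P => exact h.imp fun a' => Exists.imp fun i => And.imp (congrArg f) (hbind f _ i)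
      | out a c P =>
        exact h.imp fun a' => Exists.imp fun c' => Exists.imp fun i =>
          And.imp (congrArg f) (And.imp (congrArg f) (hB f))
    · exact fun i => let ⟨P, hP, h⟩ := h.nu i; ⟨_, List.mem_map_of_mem hP, hbind f _ i h⟩
    · exact fun i => let ⟨P, hP, h⟩ := h.tick i; ⟨_, List.mem_map_of_mem hP, hB f h⟩
    · exact fun i => let ⟨P, hP, h⟩ := h.tau i; ⟨_, List.mem_map_of_mem hP, hB f h⟩
    · exact fun a i => let ⟨P, hP, h⟩ := h.inp a i; ⟨_, List.mem_map_of_mem hP, hbind f _ i h⟩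
    · exact fun a c i => let ⟨P, hP, h⟩ := h.out a c i; ⟨_, List.mem_map_of_mem hP, hB f h⟩
    · intro i j
      obtain ⟨P, Q, hP, h₁, h₂⟩ := h.fork i j
      refine ⟨_, _, ?_, hB f h₁, hB f h₂⟩
      have := List.mem_map_of_mem (f := Guarded.subst (fun _ _ => Proc.subst) f) hP
      rwa [Guarded.subst, Proc.subst_par] at this
  · exact .inr ⟨_, _, Proc.subst_par f P₁ P₂,
      { h with
        left := fun i => hB f (h.left i)
        right := fun i => hB f (h.right i) }⟩

/-! ### Interpretations match -/

/-- Under a binder, interpreting along the extended bijection gives exactly the naming of channels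
used by `Located.bind`. -/
theorem extendBij_symm {V : Type} {n : ℕ} (h : V ≃ Fin n) :
    ⇑(extendBij h).symm = Fin.snoc (α := fun _ => Option V) (some ∘ h.symm) none := by
  funext x
  refine Fin.lastCases (by simp [extendBij]) (fun x => ?_) x
  simp only [extendBij, Equiv.symm_trans_apply, Equiv.symm_symm, finSuccEquivLast_castSucc,
    Fin.snoc_castSucc]
  rfl

theorem Definite.Equivalent.exists_next {V : Type} {n m : ℕ} {D : Definite n} {P : Proc V}
    {h : V ≃ Fin n} (e : D.Equivalent (interp P h)) {b : Basic n m} (i : D.StatesAfter b) :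
    ∃ x ∈ P.unfold.next h b, (D.after b i).Equivalent (interp x.proc x.bij) := by
  obtain ⟨j, hj⟩ := e.exists_after b i
  obtain ⟨x, hx, hx'⟩ := interp_exists_next P h b j
  exact ⟨x, hx, hj.trans hx'⟩

theorem Definite.Equivalent.exists_state {V : Type} {n m : ℕ} {D : Definite n} {P : Proc V}
    {h : V ≃ Fin n} (e : D.Equivalent (interp P h)) {b : Basic n m} {x : NumberedProc m}
    (hx : x ∈ P.unfold.next h b) :
    ∃ i : D.StatesAfter b, (D.after b i).Equivalent (interp x.proc x.bij) := by
  obtain ⟨j, hj⟩ := interp_exists_state P h b x hx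
  obtain ⟨i, hi⟩ := e.symm.exists_after b j
  exact ⟨i, hi.symm.trans hj⟩

theorem matches_interp {V : Type} {n : ℕ} (P : Proc V) (h : V ≃ Fin n) :
    Matches V P ⟨n, interp P h, h.symm⟩ := by
  -- Interpretations are closed under continuation only up to isomorphism, hence the arbitrary `D`
  -- equivalent to `interp P h`.
  let B : ItemRel := fun V P L => ∃ (n : ℕ) (D : Definite n) (h : V ≃ Fin n),
    D.Equivalent (interp P h) ∧ (⟨n, D, h.symm⟩ : Located V) = L
  refine ⟨B, ?_, n, _, h, ⟨Iso.refl _⟩, rfl⟩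
  clear P h n V
  rintro V P _ ⟨n, D, h, e, rfl⟩
  have hbind : ∀ {P : Proc (Option V)} (b : Basic n (n + 1)) (i : D.StatesAfter b),
      (D.after b i).Equivalent (interp P (extendBij h)) →
      B _ P ((⟨n, D, h.symm⟩ : Located V).bind b i) := fun {P} b i hP =>
    ⟨n + 1, _, extendBij h, hP, by rw [extendBij_symm]; rfl⟩
  have hcont : ∀ {P : Proc V} (b : Basic n n) (i : D.StatesAfter b),
      (D.after b i).Equivalent (interp P h) →
      B _ P ((⟨n, D, h.symm⟩ : Located V).cont b i) := fun {P} b i hP =>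
    ⟨n, _, h, hP, rfl⟩
  obtain ⟨gs, rfl⟩ | ⟨P, Q, rfl⟩ := P.eq_sum_or_par
  · have hu : (Proc.sum gs).unfold = .sum gs := Proc.unfold_fold _
    have key : ∀ {m} {b : Basic n m} {x} (g : Guarded Proc V), g ∈ gs → x ∈ g.next h b →
        ∃ i : D.StatesAfter b, (D.after b i).Equivalent (interp x.proc x.bij) := by
      intro m b x g hg hx
      refine e.exists_state ?_
      rw [hu]
      exact List.mem_flatMap.2 ⟨g, hg, hx⟩
    have key' : ∀ {m} {b : Basic n m} (i : D.StatesAfter b), ∃ g ∈ gs, ∃ x ∈ g.next h b,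
        (D.after b i).Equivalent (interp x.proc x.bij) := by
      intro m b i
      obtain ⟨x, hx, hi⟩ := e.exists_next i
      rw [hu] at hx
      obtain ⟨g, hg, hx⟩ := List.mem_flatMap.1 hx
      exact ⟨g, hg, x, hx, hi⟩
    refine .inl ⟨gs, rfl, ?_, ?_, ?_, ?_, ?_, ?_, ?_⟩
    · intro g hg
      cases g with
      | nu P =>
        obtain ⟨i, hi⟩ := key (b := .nu) _ hg (List.mem_singleton_self _)
        exact ⟨i, hbind _ i hi⟩
      | tick P =>
        obtain ⟨i, hi⟩ := key (b := .tick) _ hg (List.mem_singleton_self _)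
        exact ⟨i, hcont _ i hi⟩
      | tau P =>
        obtain ⟨i, hi⟩ := key (b := .tau) _ hg (List.mem_singleton_self _)
        exact .inl ⟨i, hcont _ i hi⟩
      | inp a P =>
        obtain ⟨i, hi⟩ := key (b := .inp (h a)) (x := ⟨_, P, extendBij h⟩) _ hg
          (by simp [Guarded.next])
        exact ⟨h a, i, h.symm_apply_apply a, hbind _ i hi⟩
      | out a c P =>
        obtain ⟨i, hi⟩ := key (b := .out (h a) (h c)) (x := ⟨_, P, h⟩) _ hg
          (by simp [Guarded.next])
        exact ⟨h a, h c, i, h.symm_apply_apply a, h.symm_apply_apply c, hcont _ i hi⟩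
    · intro i
      obtain ⟨g, hg, x, hx, hi⟩ := key' i
      cases g <;> simp only [Guarded.next, List.mem_singleton, List.not_mem_nil] at hx
      subst hx
      exact ⟨_, hg, hbind _ i hi⟩
    · intro i
      obtain ⟨g, hg, x, hx, hi⟩ := key' i
      cases g <;> simp only [Guarded.next, List.mem_singleton, List.not_mem_nil] at hx
      subst hx
      exact ⟨_, hg, hcont _ i hi⟩
    · intro i
      obtain ⟨g, hg, x, hx, hi⟩ := key' i
      cases g <;> simp only [Guarded.next, List.mem_singleton, List.not_mem_nil] at hx
      subst hx
      exact ⟨_, hg, hcont _ i hi⟩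
    · intro a i
      obtain ⟨g, hg, x, hx, hi⟩ := key' i
      cases g <;> simp only [Guarded.next, List.not_mem_nil, List.mem_ite_nil_right,
        List.mem_singleton] at hx
      obtain ⟨rfl, rfl⟩ := hx
      exact ⟨_, by simpa using hg, hbind _ i hi⟩
    · intro a c i
      obtain ⟨g, hg, x, hx, hi⟩ := key' i
      cases g <;> simp only [Guarded.next, List.not_mem_nil, List.mem_ite_nil_right,
        List.mem_singleton] at hx
      obtain ⟨⟨rfl, rfl⟩, rfl⟩ := hx
      exact ⟨_, by simpa using hg, hcont _ i hi⟩
    -- No guard has a continuation along a fork branch, so the clause for forks is vacuous.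
    · intro i
      obtain ⟨g, hg, x, hx, hi⟩ := key' i
      cases g <;> simp only [Guarded.next, List.not_mem_nil] at hx
  · have hu : (Proc.par P Q).unfold = .par P Q := Proc.unfold_fold _
    have key : ∀ {m} {b : Basic n m} (i : D.StatesAfter b),
        ∃ x ∈ (Layer.par P Q).next h b, (D.after b i).Equivalent (interp x.proc x.bij) := by
      intro m b i
      rw [← hu]
      exact e.exists_next i
    have hempty : ∀ {m} {b : Basic n m}, (Layer.par P Q).next h b = [] →
        IsEmpty (D.StatesAfter b) := by
      refine fun hb => ⟨fun i => ?_⟩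
      obtain ⟨x, hx, -⟩ := key i
      rw [hb] at hx
      exact List.not_mem_nil hx
    refine .inr ⟨P, Q, rfl, ?_, ?_, ?_, ?_, hempty rfl, hempty rfl, hempty rfl,
      fun _ => hempty rfl, fun _ _ => hempty rfl⟩
    · obtain ⟨i, -⟩ := e.exists_state (b := .forkL) (x := ⟨V, P, h⟩)
        (by rw [hu]; exact List.mem_singleton_self _)
      exact ⟨i⟩
    · obtain ⟨i, -⟩ := e.exists_state (b := .forkR) (x := ⟨V, Q, h⟩)
        (by rw [hu]; exact List.mem_singleton_self _)
      exact ⟨i⟩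
    · intro i
      obtain ⟨x, hx, hi⟩ := key i
      obtain rfl := List.mem_singleton.1 hx
      exact hcont _ i hi
    · intro i
      obtain ⟨x, hx, hi⟩ := key i
      obtain rfl := List.mem_singleton.1 hx
      exact hcont _ i hi

/-! ### Every located behaviour is matched by a process -/

/-- The initial states of a residual, as a list. -/
noncomputable def Definite.statesList {n m : ℕ} (D : Definite n) (b : Basic n m) :
    List (D.StatesAfter b) :=
  (@Finset.univ _ (@Fintype.ofFinite _ ((D.1.residual b).finite _))).toList

theorem Definite.mem_statesList {n m : ℕ} (D : Definite n) (b : Basic n m)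
    (i : D.StatesAfter b) : i ∈ D.statesList b := by
  simp [statesList]

/-- The guards of the process matching `D[σ]`, given processes `r` matching the continuations
and processes `p` matching pairs of continuations. -/
noncomputable def Located.guards {X : Type → Type} (r : ∀ V, Located V → X V)
    (p : ∀ V, Located V → Located V → X V) {V : Type} (L : Located V) : List (Guarded X V) :=
  (L.beh.statesList .nu).map (fun i => .nu (r _ (L.bind .nu i))) ++
  ((L.beh.statesList .tick).map (fun i => .tick (r _ (L.cont .tick i))) ++
  ((L.beh.statesList .tau).map (fun i => .tau (r _ (L.cont .tau i))) ++
  ((List.finRange L.n).flatMap (fun a =>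
    (L.beh.statesList (.inp a)).map (fun i => .inp (L.sub a) (r _ (L.bind (.inp a) i)))) ++
  ((List.finRange L.n).flatMap (fun a => (List.finRange L.n).flatMap (fun c =>
    (L.beh.statesList (.out a c)).map
      (fun i => .out (L.sub a) (L.sub c) (r _ (L.cont (.out a c) i))))) ++
  (L.beh.statesList .forkL).flatMap (fun i => (L.beh.statesList .forkR).map
    (fun j => .tau (p _ (L.cont .forkL i) (L.cont .forkR j))))))))

/-- Naturality in the continuations; it serves both to truncate finite approximations and to compare
them with the limit process. -/
theorem Located.map_guards {X Y : Type → Type} (f : ∀ V, X V → Y V) (r : ∀ V, Located V → X V)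
    (p : ∀ V, Located V → Located V → X V) {V : Type} (L : Located V) :
    (L.guards r p).map (Guarded.map f) =
      L.guards (fun V L => f V (r V L)) (fun V L L' => f V (p V L L')) := by
  simp only [guards, List.map_append, List.map_map, List.map_flatMap, Function.comp_def,
    Guarded.map]

/-- Finite approximations of the process matching `D[σ]` and of the parallel composition
matching a pair of located behaviours. -/
noncomputable def Located.approx : ∀ k : ℕ,
    (∀ V, Located V → Approx k V) × (∀ V, Located V → Located V → Approx k V)
  | 0 => (fun _ _ => (), fun _ _ _ => ())
  -- A guard `τ. (P ∣ Q)` spans two layers of syntax. Approximating pairs as a second component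
  -- keeps the recursion at one layer per step.
  | k + 1 => (fun _ L => Layer.sum (L.guards (Located.approx k).1 (Located.approx k).2),
      fun _ L L' => Layer.par ((Located.approx k).1 _ L) ((Located.approx k).1 _ L'))

theorem Located.trunc_approx : ∀ k : ℕ,
    (∀ V L, Approx.trunc k V ((Located.approx (k + 1)).1 V L) = (Located.approx k).1 V L) ∧
    (∀ V L L', Approx.trunc k V ((Located.approx (k + 1)).2 V L L') =
      (Located.approx k).2 V L L')
  | 0 => ⟨fun _ _ => rfl, fun _ _ _ => rfl⟩
  | k + 1 => by
    obtain ⟨h₁, h₂⟩ := Located.trunc_approx k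
    refine ⟨fun V L => ?_, fun V L L' => ?_⟩
    · refine congrArg Layer.sum ((Located.map_guards (Approx.trunc k) _ _ L).trans ?_)
      simp only [h₁, h₂]
    · exact congrArg₂ Layer.par (h₁ V L) (h₁ V L')

/-- The process matching `D[σ]`. -/
noncomputable def Located.toProc {V : Type} (L : Located V) : Proc V :=
  ⟨fun k => (Located.approx k).1 V L, fun k => (Located.trunc_approx k).1 V L⟩

/-- The corecursive equation for `toProc`, checked depth by depth: the second component of
`Located.approx` is precisely the approximation of the parallel composition of two such processes.
-/
theorem Located.toProc_eq {V : Type} (L : Located V) :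
    L.toProc = Proc.sum (L.guards (fun _ => toProc)
      (fun _ L L' => Proc.par L.toProc L'.toProc)) := by
  have hp : ∀ (k : ℕ) (V : Type) (L L' : Located V),
      Proc.approx k V (Proc.par L.toProc L'.toProc) = (Located.approx k).2 V L L' := by
    intro k V L L'
    cases k <;> rfl
  refine Proc.ext_approx fun k => ?_
  cases k with
  | zero => rfl
  | succ k =>
    refine congrArg Layer.sum (Eq.trans ?_ (Located.map_guards (Proc.approx k) _ _ L).symm)
    simp only [hp]
    rfl

theorem matches_toProc {V : Type} (L : Located V) : Matches V L.toProc L := by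
  -- The graph of `toProc` is itself a matching relation. Every value is a sum, so only `SumMatch`
  -- arises, even for behaviours that can fork.
  refine ⟨fun V P L => P = L.toProc, ?_, rfl⟩
  clear L V
  rintro V _ L rfl
  refine .inl ⟨_, L.toProc_eq, ?_⟩
  have hs := @Definite.mem_statesList
  constructor
  · intro g hg
    simp only [Located.guards, List.mem_append, List.mem_map, List.mem_flatMap] at hg
    obtain ⟨i, -, rfl⟩ | ⟨i, -, rfl⟩ | ⟨i, -, rfl⟩ | ⟨a, -, i, -, rfl⟩ | ⟨a, -, c, -, i, -, rfl⟩ |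
      ⟨i, -, j, -, rfl⟩ := hg
    · exact ⟨i, rfl⟩
    · exact ⟨i, rfl⟩
    · exact .inl ⟨i, rfl⟩
    · exact ⟨a, i, rfl, rfl⟩
    · exact ⟨a, c, i, rfl, rfl, rfl⟩
    · exact .inr ⟨i, j, _, _, rfl, rfl, rfl⟩
  · exact fun i => ⟨_, by simp [Located.guards, hs], rfl⟩
  · exact fun i => ⟨_, by simp [Located.guards, hs], rfl⟩
  · exact fun i => ⟨_, by simp [Located.guards, hs], rfl⟩
  · exact fun a i => ⟨_, by simpa [Located.guards, hs] using ⟨a, rfl, i, rfl⟩, rfl⟩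
  · exact fun a c i => ⟨_, by simpa [Located.guards, hs] using ⟨a, rfl, c, rfl, i, rfl⟩, rfl⟩
  · exact fun i j => ⟨_, _, by simp [Located.guards, hs], rfl, rfl⟩

/-! ### Simulations and the pole -/

namespace TransitionGraph

variable {G H : TransitionGraph}

/-- Weak simulations between two graphs. -/
def IsWeakSimulation (G H : TransitionGraph) (R : G.Obj → H.Obj → Prop) : Prop :=
  ∀ x y, R x y → ∀ α x', G.Step x α x' → ∃ y', H.Weak y α y' ∧ R x' y'

theorem IsWeakSimulation.silent {R : G.Obj → H.Obj → Prop} (hR : IsWeakSimulation G H R)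
    {x x' : G.Obj} {y : H.Obj} (hxy : R x y) (h : G.Silent x x') :
    ∃ y', H.Silent y y' ∧ R x' y' := by
  induction h with
  | refl => exact ⟨y, .refl, hxy⟩
  | tail _ h ih =>
    obtain ⟨y₁, h₁, hxy₁⟩ := ih
    obtain ⟨y₂, h₂, hxy₂⟩ := hR _ _ hxy₁ _ _ h
    exact ⟨y₂, h₁.trans h₂, hxy₂⟩

theorem IsWeakSimulation.exists_tick {R : G.Obj → H.Obj → Prop} (hR : IsWeakSimulation G H R)
    {x : G.Obj} {y : H.Obj} (hxy : R x y) (h : ∃ z, G.Weak x .tick z) :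
    ∃ z, H.Weak y .tick z := by
  -- Only the existence of a `♡` matters, so the silent sequence after it is dropped.
  obtain ⟨z, u, v, hu, huv, -⟩ := h
  obtain ⟨u', hu', hR'⟩ := hR.silent hxy hu
  obtain ⟨v', ⟨s, t, hs, hst, ht⟩, -⟩ := hR _ _ hR' _ _ huv
  exact ⟨v', s, t, hu'.trans hs, hst, ht⟩

/-- A silent sequence from `y` pulls back to one from `x` along the reverse simulation; the `♡` that
the pole guarantees there is pushed forward again. -/
theorem Pole.of_simulations {R : G.Obj → H.Obj → Prop} (hR : IsWeakSimulation G H R)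
    (hR' : IsWeakSimulation H G (flip R)) {x : G.Obj} {y : H.Obj} (hxy : R x y)
    (hx : G.Pole x) : H.Pole y := by
  intro y' hy'
  obtain ⟨x', hx', h⟩ := hR'.silent hxy hy'
  exact hR.exists_tick h (hx x' hx')

theorem pole_iff_of_simulations {R : G.Obj → H.Obj → Prop} (hR : IsWeakSimulation G H R)
    (hR' : IsWeakSimulation H G (flip R)) {x : G.Obj} {y : H.Obj} (hxy : R x y) :
    G.Pole x ↔ H.Pole y :=
  ⟨Pole.of_simulations hR hR' hxy, Pole.of_simulations (R := flip R) hR' hR hxy⟩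

theorem weak_of_silent_of_step {x y z : G.Obj} {α : Label} (h : G.Silent x y)
    (h' : G.Step y α z) : G.Weak x α z := by
  cases α with
  | tau => exact h.tail h'
  | tick => exact ⟨y, z, h, h', .refl⟩

end TransitionGraph

/-! ### Configurations related to mixed behaviours -/

/-- A process accounts for a matching located behaviour, or for a pair of located behaviours
if it is a parallel composition. -/
def Block {V : Type} (P : Proc V) (b : Multiset (Located V)) : Prop :=
  (∃ L, b = {L} ∧ Matches V P L) ∨ ∃ P₁ P₂ L₁ L₂, P = Proc.par P₁ P₂ ∧ b = {L₁, L₂} ∧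
    Matches V P₁ L₁ ∧ Matches V P₂ L₂

/-- The processes in `S` account for the elements of `Y`. -/
def Cover {V : Type} (S : Multiset (Proc V)) (Y : Multiset (Located V)) : Prop :=
  ∃ B, Multiset.Rel Block S B ∧ B.join = Y

section

variable {V W : Type} {S S' : Multiset (Proc V)} {Y Y' : Multiset (Located V)} {P Q : Proc V}

theorem Block.cover {b : Multiset (Located V)} (h : Block P b) : Cover {P} b :=
  ⟨b ::ₘ 0, .cons h .zero, by simp⟩

theorem Matches.block {L : Located V} (h : Matches V P L) : Block P {L} := .inl ⟨L, rfl, h⟩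

theorem Matches.cover {L : Located V} (h : Matches V P L) : Cover {P} {L} := h.block.cover

theorem Cover.add (h : Cover S Y) (h' : Cover S' Y') : Cover (S + S') (Y + Y') := by
  obtain ⟨B, hB, rfl⟩ := h
  obtain ⟨B', hB', rfl⟩ := h'
  exact ⟨B + B', hB.add hB', Multiset.join_add B B'⟩

theorem Cover.pair {L M : Located V} (h : Matches V P L) (h' : Matches V Q M) :
    Cover {P, Q} {L, M} :=
  h.cover.add h'.cover

theorem Cover.exists_of_add (h : Cover (S + S') Y) :
    ∃ Y₁ Y₂, Y = Y₁ + Y₂ ∧ Cover S Y₁ ∧ Cover S' Y₂ := by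
  obtain ⟨B, hB, rfl⟩ := h
  obtain ⟨B₁, B₂, h₁, h₂, rfl⟩ := Multiset.rel_add_left.1 hB
  exact ⟨_, _, Multiset.join_add B₁ B₂, ⟨_, h₁, rfl⟩, _, h₂, rfl⟩

theorem Cover.block (h : Cover {P} Y) : Block P Y := by
  obtain ⟨B, hB, rfl⟩ := h
  obtain ⟨b, B', hb, hB', rfl⟩ := Multiset.rel_cons_left.1 hB
  rw [Multiset.rel_zero_left.1 hB']
  simpa using hb

theorem Cover.of_sum {gs : List (Guarded Proc V)} (hY : Cover {Proc.sum gs} Y) :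
    ∃ L, Y = {L} ∧ SumMatch Matches gs L := by
  obtain ⟨L, rfl, h⟩ | ⟨P₁, P₂, L₁, L₂, e, -⟩ := hY.block
  · exact ⟨L, rfl, h.sumMatch⟩
  · exact absurd e (Proc.sum_ne_par _ _ _)

theorem Cover.subst (f : V → W) (h : Cover S Y) :
    Cover (S.map (Proc.subst f)) (Y.map (Located.rename f)) := by
  obtain ⟨B, hB, rfl⟩ := h
  refine ⟨B.map (Multiset.map (Located.rename f)), ?_, (Multiset.map_join _ B).symm⟩
  refine Multiset.rel_map.2 (hB.mono fun P _ b _ hb => ?_)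
  obtain ⟨L, rfl, h⟩ | ⟨P₁, P₂, L₁, L₂, rfl, rfl, h₁, h₂⟩ := hb
  · exact .inl ⟨_, rfl, h.subst f⟩
  · exact .inr ⟨_, _, _, _, Proc.subst_par f P₁ P₂, rfl, h₁.subst f, h₂.subst f⟩

theorem Cover.of_rel (h : Multiset.Rel (Matches V) S Y) : Cover S Y := by
  induction h with
  | zero => exact ⟨0, .zero, rfl⟩
  | cons h _ ih => exact h.cover.add ih

end

/-- Weakening along `γ ⊆ γ` is substitution by the identity, so it leaves the context unchanged. -/
theorem Conf.Step.ctx_same {γ : Finset ℕ} {S₁ S₂ : Multiset (Proc γ)} {α : Label}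
    (h : Conf.Step ⟨γ, S₁⟩ α ⟨γ, S₂⟩) (S : Multiset (Proc γ)) :
    Conf.Step ⟨γ, S + S₁⟩ α ⟨γ, S + S₂⟩ := by
  have := Conf.Step.ctx γ γ subset_rfl S S₁ S₂ α h
  rwa [show Proc.subst (incl (subset_rfl : γ ⊆ γ)) = id from funext Proc.subst_id,
    Multiset.map_id] at this

/-- After decomposing parallel compositions, processes and located behaviours match one by
one. -/
theorem Cover.exists_rel {γ : Finset ℕ} {S : Multiset (Proc γ)} {Y : Multiset (Located γ)}
    (h : Cover S Y) (S₀ : Multiset (Proc γ)) :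
    ∃ S', confGraph.Silent ⟨γ, S₀ + S⟩ ⟨γ, S₀ + S'⟩ ∧ Multiset.Rel (Matches γ) S' Y := by
  obtain ⟨B, hB, rfl⟩ := h
  -- The context `S₀` must vary: processes already decomposed are moved into it.
  induction hB generalizing S₀ with
  | zero => exact ⟨0, .refl, .zero⟩
  | @cons P b S B hb _ ih =>
    have hadd : ∀ T : Multiset (Proc γ), Multiset.Rel (Matches γ) T b →
        ∃ S', confGraph.Silent ⟨γ, S₀ + (T + S)⟩ ⟨γ, S₀ + S'⟩ ∧
          Multiset.Rel (Matches γ) S' (b ::ₘ B).join := by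
      intro T hT
      obtain ⟨S', h, h'⟩ := ih (S₀ + T)
      refine ⟨T + S', by simpa only [add_assoc] using h, ?_⟩
      rw [Multiset.join_cons]
      exact hT.add h'
    obtain ⟨L, rfl, h⟩ | ⟨P₁, P₂, L₁, L₂, rfl, rfl, h₁, h₂⟩ := hb
    · exact hadd {P} (.cons h .zero)
    · obtain ⟨S', h, h'⟩ := hadd {P₁, P₂} (.cons h₁ (.cons h₂ .zero))
      refine ⟨S', Relation.ReflTransGen.head ?_ h, h'⟩
      have := (Conf.Step.heat γ P₁ P₂).ctx_same (S₀ + S)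
      rw [add_assoc, add_assoc, add_comm S, add_comm S] at this
      exact this

/-- Configurations and mixed behaviours over the same channels, the former covering the
latter. -/
inductive Related : Conf → Mixed → Prop
  | mk {γ : Finset ℕ} {S : Multiset (Proc γ)} {Y : Multiset (Located γ)} (h : Cover S Y) :
    Related ⟨γ, S⟩ ⟨γ, Y⟩

/-- A single mixed transition always suffices: a behaviour forks either at a heating or already at
the `τ` guard encoding the fork, and in the latter case the later heating is matched by an identity.
-/
theorem Conf.Step.exists_mixedStep {x x' : Conf} {α : Label} (h : Conf.Step x α x') :
    ∀ Y, Cover x.items Y →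
      ∃ Y', Mixed.Step ⟨x.chan, Y⟩ α ⟨x'.chan, Y'⟩ ∧ Cover x'.items Y' := by
  induction h with
  | refl x => exact fun Y h => ⟨Y, .refl _, h⟩
  | heat γ P Q =>
    intro Y hY
    obtain ⟨⟨n, D, σ⟩, rfl, h⟩ | ⟨P₁, P₂, L₁, L₂, e, rfl, h₁, h₂⟩ := hY.block
    · have h := h.parMatch
      obtain ⟨i⟩ := h.left_exists
      obtain ⟨j⟩ := h.right_exists
      exact ⟨_, .fork γ n D σ i j, .pair (h.left i) (h.right j)⟩
    -- The behaviour has forked earlier, so heating is answered by the identity.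
    · obtain ⟨rfl, rfl⟩ := Proc.par_inj e
      exact ⟨_, .refl _, .pair h₁ h₂⟩
  | tau γ gs P hP =>
    intro Y hY
    obtain ⟨⟨n, D, σ⟩, rfl, h⟩ := hY.of_sum
    obtain ⟨i, hi⟩ | ⟨i, j, P₁, P₂, rfl, h₁, h₂⟩ := h.guard _ hP
    · exact ⟨_, .tau γ n D σ i, hi.cover⟩
    -- The guard encodes a fork; its continuation, still unsplit, covers both branches.
    · exact ⟨_, .fork γ n D σ i j, Block.cover (.inr ⟨_, _, _, _, rfl, rfl, h₁, h₂⟩)⟩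
  | tick γ gs P hP =>
    intro Y hY
    obtain ⟨⟨n, D, σ⟩, rfl, h⟩ := hY.of_sum
    obtain ⟨i, hi⟩ := h.guard _ hP
    exact ⟨_, .tick γ n D σ i, hi.cover⟩
  | nu γ gs P hP a ha =>
    intro Y hY
    obtain ⟨⟨n, D, σ⟩, rfl, h⟩ := hY.of_sum
    obtain ⟨i, hi⟩ := h.guard _ hP
    refine ⟨_, .nu γ n D σ i a ha, ?_⟩
    have := (hi.subst (addName id a)).cover
    rwa [Located.rename_bind_addName] at this
  | sync γ gs gs' a c P Q hP hQ =>
    intro Y hY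
    obtain ⟨Y₁, Y₂, rfl, hY₁, hY₂⟩ := Cover.exists_of_add (S := {_}) (S' := {_}) hY
    obtain ⟨⟨n₁, D₁, σ₁⟩, rfl, h₁⟩ := hY₁.of_sum
    obtain ⟨⟨n₂, D₂, σ₂⟩, rfl, h₂⟩ := hY₂.of_sum
    obtain ⟨a₁, i, ha₁, hi⟩ := h₁.guard _ hP
    obtain ⟨a₂, b₂, j, ha₂, hb₂, hj⟩ := h₂.guard _ hQ
    refine ⟨_, .sync γ n₁ n₂ D₁ D₂ σ₁ σ₂ a₁ a₂ b₂ i j (ha₁.trans ha₂.symm), .pair ?_ hj⟩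
    have := hi.subst (fun x => x.getD c)
    rw [Located.rename_bind_getD, ← hb₂] at this
    rw [← hb₂]
    exact this
  | ctx γ₁ γ₂ hγ S S₁ S₂ α _ ih =>
    intro Y hY
    obtain ⟨Y₁, Y₂, rfl, hY₁, hY₂⟩ := Cover.exists_of_add hY
    obtain ⟨Y', h, h'⟩ := ih Y₂ hY₂
    exact ⟨_, .ctx γ₁ γ₂ hγ Y₁ Y₂ Y' α h, (hY₁.subst (incl hγ)).add h'⟩

theorem exists_eq_singleton_of_rel {V : Type} {S : Multiset (Proc V)} {L : Located V}
    (h : Multiset.Rel (Matches V) S {L}) : ∃ P, S = {P} ∧ Matches V P L := by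
  obtain ⟨P, S', hP, hS', rfl⟩ := Multiset.rel_cons_right.1 h
  rw [Multiset.rel_zero_right.1 hS']
  exact ⟨P, rfl, hP⟩

/-- A state along any action other than a fork branch excludes `ParMatch`, which forces the process
to be a sum. -/
theorem Matches.exists_sum {V : Type} {P : Proc V} {L : Located V} (h : Matches V P L)
    (hpar : ∀ P₁ P₂, ¬ ParMatch Matches P₁ P₂ L) :
    ∃ gs, P = Proc.sum gs ∧ SumMatch Matches gs L :=
  h.layerMatch.resolve_right fun ⟨P₁, P₂, _, h⟩ => hpar P₁ P₂ h

/-- Items must match one by one here, since an unsplit parallel composition cannot perform the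
actions of its components. The conclusion is only a `Cover`, because a fork simulated by a `τ` guard
ends in such an unsplit composition. -/
theorem Mixed.Step.exists_confStep {y y' : Mixed} {α : Label} (h : Mixed.Step y α y') :
    ∀ S, Multiset.Rel (Matches y.chan) S y.items →
      ∃ S', Conf.Step ⟨y.chan, S⟩ α ⟨y'.chan, S'⟩ ∧ Cover S' y'.items := by
  induction h with
  | refl y => exact fun S h => ⟨S, .refl _, .of_rel h⟩
  | fork γ n D σ i j =>
    intro S hS
    obtain ⟨P, rfl, hP⟩ := exists_eq_singleton_of_rel hS
    obtain ⟨gs, rfl, h⟩ | ⟨P₁, P₂, rfl, h⟩ := hP.layerMatch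
    · obtain ⟨P, Q, hPQ, h₁, h₂⟩ := h.fork i j
      exact ⟨_, .tau γ gs _ hPQ, Block.cover (.inr ⟨_, _, _, _, rfl, rfl, h₁, h₂⟩)⟩
    · exact ⟨_, .heat γ P₁ P₂, .pair (h.left i) (h.right j)⟩
  | tau γ n D σ i =>
    intro S hS
    obtain ⟨P, rfl, hP⟩ := exists_eq_singleton_of_rel hS
    obtain ⟨gs, rfl, h⟩ := hP.exists_sum fun _ _ h => h.tau.false i
    obtain ⟨P, hP, h⟩ := h.tau i
    exact ⟨_, .tau γ gs P hP, h.cover⟩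
  | tick γ n D σ i =>
    intro S hS
    obtain ⟨P, rfl, hP⟩ := exists_eq_singleton_of_rel hS
    obtain ⟨gs, rfl, h⟩ := hP.exists_sum fun _ _ h => h.tick.false i
    obtain ⟨P, hP, h⟩ := h.tick i
    exact ⟨_, .tick γ gs P hP, h.cover⟩
  | nu γ n D σ i a ha =>
    intro S hS
    obtain ⟨P, rfl, hP⟩ := exists_eq_singleton_of_rel hS
    obtain ⟨gs, rfl, h⟩ := hP.exists_sum fun _ _ h => h.nu.false i
    obtain ⟨P, hP, h⟩ := h.nu i
    refine ⟨_, .nu γ gs P hP a ha, ?_⟩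
    have := (h.subst (addName id a)).cover
    rwa [Located.rename_bind_addName] at this
  | sync γ n₁ n₂ D₁ D₂ σ₁ σ₂ a₁ a₂ b₂ i j e =>
    intro S hS
    obtain ⟨S₁, S₂, hS₁, hS₂, rfl⟩ := Multiset.rel_add_right (bs₀ := {_}) (bs₁ := {_}) |>.1 hS
    obtain ⟨P₁, rfl, hP₁⟩ := exists_eq_singleton_of_rel hS₁
    obtain ⟨P₂, rfl, hP₂⟩ := exists_eq_singleton_of_rel hS₂
    obtain ⟨gs₁, rfl, h₁⟩ := hP₁.exists_sum fun _ _ h => (h.inp a₁).false i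
    obtain ⟨gs₂, rfl, h₂⟩ := hP₂.exists_sum fun _ _ h => (h.out a₂ b₂).false j
    obtain ⟨P, hP, h₁⟩ := h₁.inp a₁ i
    obtain ⟨Q, hQ, h₂⟩ := h₂.out a₂ b₂ j
    change Guarded.inp (σ₁ a₁) P ∈ gs₁ at hP
    rw [e] at hP
    refine ⟨_, .sync γ gs₁ gs₂ (σ₂ a₂) (σ₂ b₂) P Q hP hQ, .pair ?_ h₂⟩
    have := h₁.subst (fun x => x.getD (σ₂ b₂))
    rwa [Located.rename_bind_getD] at this
  | ctx γ₁ γ₂ hγ Y Y₁ Y₂ α _ ih =>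
    intro S hS
    obtain ⟨S₁, S₂, h₁, h₂, rfl⟩ := Multiset.rel_add_right.1 hS
    obtain ⟨S', h, h'⟩ := ih S₂ h₂
    exact ⟨_, .ctx γ₁ γ₂ hγ S₁ S₂ S' α h, ((Cover.of_rel h₁).subst (incl hγ)).add h'⟩

theorem Related.isWeakSimulation : TransitionGraph.IsWeakSimulation
    confGraph.toTransitionGraph mixedGraph.toTransitionGraph Related := by
  rintro _ _ ⟨h⟩ α x' hs
  obtain ⟨Y', hs', h'⟩ := Conf.Step.exists_mixedStep hs _ h
  exact ⟨_, TransitionGraph.weak_of_silent_of_step .refl hs', .mk h'⟩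

theorem Related.isWeakSimulation_flip : TransitionGraph.IsWeakSimulation
    mixedGraph.toTransitionGraph confGraph.toTransitionGraph (flip Related) := by
  rintro _ _ ⟨h⟩ α y' hs
  -- All pending parallel compositions are heated before the step is answered; this is why the
  -- simulation is weak in this direction.
  obtain ⟨S₁, hs₁, h₁⟩ := h.exists_rel 0
  obtain ⟨S', hs', h'⟩ := Mixed.Step.exists_confStep hs _ h₁
  rw [zero_add, zero_add] at hs₁
  exact ⟨_, TransitionGraph.weak_of_silent_of_step hs₁ hs', .mk h'⟩

theorem Related.pole_iff {x : Conf} {y : Mixed} (h : Related x y) :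
    confGraph.Pole x ↔ mixedGraph.Pole y :=
  TransitionGraph.pole_iff_of_simulations Related.isWeakSimulation
    Related.isWeakSimulation_flip h

/-! ### Full abstraction -/

theorem Cover.translation {γ : Finset ℕ} (S : Multiset (Proc γ)) :
    Cover S (PiFair.translation ⟨γ, S⟩).items :=
  .of_rel (Multiset.rel_map_right.2 (Multiset.rel_refl_of_refl_on fun P _ =>
    matches_interp P (orderBij γ)))

theorem Cover.toProc {γ : Finset ℕ} (Y : Multiset (Located γ)) :
    Cover (Y.map Located.toProc) Y :=
  .of_rel (Multiset.rel_map_left.2 (Multiset.rel_refl_of_refl_on fun L _ => matches_toProc L))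

/-- Composition is deterministic and defined exactly over equal channel sets, so fair testing over
`γ` amounts to adding an arbitrary multiset over the same `γ`. -/
theorem Soup.fairTesting_iff {F : Type → Type*} (p : Soup F → Prop) {γ : Finset ℕ}
    {S S' : Multiset (F γ)} :
    ((∃ z, Soup.At ⟨γ, S⟩ ⟨γ, S'⟩ z) ∧ ∀ z, (∃ u, Soup.At z ⟨γ, S⟩ u) →
      ((∃ u, Soup.At ⟨γ, S⟩ z u ∧ p u) ↔ ∃ v, Soup.At ⟨γ, S'⟩ z v ∧ p v)) ↔
    ∀ Z, p ⟨γ, S + Z⟩ ↔ p ⟨γ, S' + Z⟩ := by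
  have hp : ∀ T Z : Multiset (F γ), (∃ u, Soup.At ⟨γ, T⟩ ⟨γ, Z⟩ u ∧ p u) ↔ p ⟨γ, T + Z⟩ :=
    fun T Z => ⟨fun ⟨_, hu, h⟩ => Soup.at_functional hu (.mk γ T Z) ▸ h,
      fun h => ⟨_, .mk γ T Z, h⟩⟩
  constructor
  · rintro ⟨-, h⟩ Z
    rw [← hp, ← hp]
    exact h ⟨γ, Z⟩ ⟨_, .mk γ Z S⟩
  · refine fun h => ⟨⟨_, .mk γ S S'⟩, ?_⟩
    rintro _ ⟨_, ⟨_, Z, _⟩⟩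
    rw [hp, hp]
    exact h Z

theorem confGraph_fairEquiv_iff {γ : Finset ℕ} {S S' : Multiset (Proc γ)} :
    confGraph.FairEquiv (⟨γ, S⟩ : Conf) (⟨γ, S'⟩ : Conf) ↔ ∀ Z : Multiset (Proc γ),
      confGraph.Pole (⟨γ, S + Z⟩ : Conf) ↔ confGraph.Pole (⟨γ, S' + Z⟩ : Conf) :=
  Soup.fairTesting_iff confGraph.Pole

theorem mixedGraph_fairEquiv_iff {γ : Finset ℕ} {Y Y' : Multiset (Located γ)} :
    mixedGraph.FairEquiv (⟨γ, Y⟩ : Mixed) (⟨γ, Y'⟩ : Mixed) ↔ ∀ Z : Multiset (Located γ),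
      mixedGraph.Pole (⟨γ, Y + Z⟩ : Mixed) ↔ mixedGraph.Pole (⟨γ, Y' + Z⟩ : Mixed) :=
  Soup.fairTesting_iff mixedGraph.Pole

/-- The link between the two systems: a state and a test may be covered independently, by whichever
construction is available. -/
theorem Cover.pole_iff {γ : Finset ℕ} {S Z : Multiset (Proc γ)} {Y Y' : Multiset (Located γ)}
    (h : Cover S Y) (h' : Cover Z Y') :
    confGraph.Pole (⟨γ, S + Z⟩ : Conf) ↔ mixedGraph.Pole (⟨γ, Y + Y'⟩ : Mixed) :=
  Related.pole_iff (.mk (h.add h'))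

theorem translation_intensionallyFullyAbstract :
    TestingGraph.IntensionallyFullyAbstract confGraph mixedGraph translation := by
  refine ⟨?_, ?_⟩
  · rintro ⟨γ, S⟩ ⟨γ', S'⟩
    by_cases hγ : γ = γ'
    · subst hγ
      refine confGraph_fairEquiv_iff.trans (Iff.trans ?_ mixedGraph_fairEquiv_iff.symm)
      refine ⟨fun h Z => ?_, fun h Z => ?_⟩
      -- The mixed test `Z` is replaced by its matching processes.
      · exact ((Cover.translation S).pole_iff (.toProc Z)).symm.trans
          ((h _).trans ((Cover.translation S').pole_iff (.toProc Z)))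
      -- The test `Z` made of processes is replaced by its translation.
      · exact ((Cover.translation S).pole_iff (.translation Z)).trans
          ((h _).trans ((Cover.translation S').pole_iff (.translation Z)).symm)
    -- Over different channel sets neither pair can be tested together, since `translation` keeps
    -- the channels.
    · refine iff_of_false ?_ ?_
      · rintro ⟨⟨_, ⟨⟩⟩, -⟩
        exact hγ rfl
      · rintro ⟨⟨z, hz⟩, -⟩
        have key : ∀ {x y z : Mixed}, Soup.At x y z → x.chan = y.chan := by
          rintro _ _ _ ⟨⟩
          rfl
        exact hγ (key hz)
  · rintro ⟨γ, Y⟩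
    refine ⟨⟨γ, Y.map Located.toProc⟩, mixedGraph_fairEquiv_iff.2 fun Z => ?_⟩
    -- The configuration of matching processes covers both its own translation and `Y`, so each is
    -- compared with it under the same test.
    exact ((Cover.translation _).pole_iff (.toProc Z)).symm.trans
      ((Cover.toProc Y).pole_iff (.toProc Z))

end PiFair

theorem mainTheorem5 :
    PiFair.TestingGraph.IntensionallyFullyAbstract PiFair.confGraph PiFair.mixedGraph
      PiFair.translation := by
  exact PiFair.translation_intensionallyFullyAbstract
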